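/- **Lemma 2.** Let $s,n$ be natural numbers and let $\mathcal H=L^2(\mathbb R^s)$ carry the canonical observables $R=[q_1,p_1,\dots,q_s,p_s]$ ($q_j$ multiplication by the $j$-th coordinate, $p_j=-i\,\partial/\partial\xi_j$). For $z=[x_1,y_1,\dots,x_s,y_s]^t\in\mathbb R^{2s}$ let $D(z)=\exp i\sum_{j}(y_jq_j-x_jp_j)$ be the unitary displacement operator, that is, $(D(z)\psi)(\xi)=e^{i\sum_j y_j(\xi_j-x_j/2)}\psi(\xi-x)$. Let $\rho_\beta$ be the centered Gaussian density operator with (real symmetric) covariance matrix $\beta$, i.e. $\operatorname{Tr}\rho_\beta D(z)=\exp(-\tfrac12 w^t\beta w)$ with $w=[y_1,-x_1,\dots,y_s,-x_s]^t$ for all $z$, and let $M$ be the observable (POVM) $M(d^{2s}z)=m(z)\,\mu(dz)$ with $m(z)=D(z)\rho_\beta D(z)^*$, $\mu(dz)=d^{2s}z/(2\pi)^s$. On $\mathcal H^{\otimes n}=L^2((\mathbb R^s)^n)$ put, for $\tilde z=(z^{(1)},\dots,z^{(n)})\in(\mathbb R^{2s})^n$, $D(\tilde z)=D(z^{(1)})\otimes\dots\otimes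 D(z^{(n)})$, $\tilde m(\tilde z)=m(z^{(1)})\otimes\dots\otimes m(z^{(n)})$, and let $M^{\otimes n}$ be the observable $\tilde m(\tilde z)\,\mu(dz^{(1)})\cdots\mu(dz^{(n)})$. For a state (density operator) $\rho$ let $p_\rho(\tilde z)=\operatorname{Tr}\rho\,\tilde m(\tilde z)$ and $h_{M^{\otimes n}}(\rho)=-\int p_\rho\log p_\rho\,d\mu^{\otimes n}\in[0,+\infty]$, and let $$e_{M^{\otimes n}}(\rho)=\inf\int_{\mathcal X} h_{M^{\otimes n}}(\rho(x))\,\pi(dx)\in[0,+\infty],$$ where the infimum is over all ensembles $\{\pi(dx),\rho(x)\}$ ($\pi$ a probability measure on a standard Borel space $\mathcal X$, $x\mapsto\rho(x)$ a measurable family of states) with average state $\int\rho(x)\,\pi(dx)=\rho$, a Bochner integral in the space of trace-class operators. Let $O=[O_{kl}]$ be a real orthogonal $n\times n$ matrix, acting by $(O\tilde z)^{(k)}=\sum_l O_{kl}z^{(l)}$. Then there is a unitary operator $U$ on $\mathcal H^{\otimes n}$ implementing the linear symplectic transformation $\tilde R=[R^{(1)},\dots,R^{(n)}]\mapsto\tilde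 R\,O$, that is, such that $$U^*D(\tilde z)U=D(O\tilde z)\qquad\text{for all }\tilde z,$$ and every such $U$ satisfies $U^*\rho_\beta^{\otimes n}U=\rho_\beta^{\otimes n}$ and, for every state $\tilde\rho$ on $\mathcal H^{\otimes n}$, $$e_{M^{\otimes n}}(\tilde\rho)=e_{M^{\otimes n}}(U\tilde\rho U^*).$$ -/

import Mathlib

open MeasureTheory
open scoped ENNReal InnerProductSpace

noncomputable section

namespace QMeas

section TraceClass

variable {K : Type*} [NormedAddCommGroup K] [InnerProductSpace ℂ K]

/-- The trace norm `‖T‖₁`, as an extended nonnegative number: the supremum of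
`∑ |⟨eᵢ, T fᵢ⟩|` over all pairs of finite orthonormal families. -/
def trNorm (T : K →L[ℂ] K) : ℝ≥0∞ :=
  ⨆ (N : ℕ) (e : Fin N → K) (f : Fin N → K) (_ : Orthonormal ℂ e) (_ : Orthonormal ℂ f),
    ∑ i, ‖⟪e i, T (f i)⟫_ℂ‖ₑ

theorem le_trNorm (T : K →L[ℂ] K) {N : ℕ} {e f : Fin N → K} (he : Orthonormal ℂ e)
    (hf : Orthonormal ℂ f) : ∑ i, ‖⟪e i, T (f i)⟫_ℂ‖ₑ ≤ trNorm T :=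
  le_iSup_of_le N <| le_iSup_of_le e <| le_iSup_of_le f <| le_iSup_of_le he <|
    le_iSup_of_le hf le_rfl

theorem trNorm_le {T : K →L[ℂ] K} {c : ℝ≥0∞}
    (h : ∀ (N : ℕ) (e f : Fin N → K), Orthonormal ℂ e → Orthonormal ℂ f →
      ∑ i, ‖⟪e i, T (f i)⟫_ℂ‖ₑ ≤ c) : trNorm T ≤ c :=
  iSup_le fun N => iSup_le fun e => iSup_le fun f => iSup_le fun he => iSup_le fun hf =>
    h N e f he hf

theorem trNorm_zero : trNorm (0 : K →L[ℂ] K) = 0 :=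
  le_antisymm (trNorm_le fun N e f _ _ => by simp) bot_le

theorem trNorm_add_le (S T : K →L[ℂ] K) : trNorm (S + T) ≤ trNorm S + trNorm T := by
  refine trNorm_le fun N e f he hf => ?_
  calc ∑ i, ‖⟪e i, (S + T) (f i)⟫_ℂ‖ₑ
      ≤ ∑ i, (‖⟪e i, S (f i)⟫_ℂ‖ₑ + ‖⟪e i, T (f i)⟫_ℂ‖ₑ) := by
        refine Finset.sum_le_sum fun i _ => ?_
        rw [add_apply, inner_add_right]
        exact enorm_add_le _ _
    _ ≤ _ := by
        rw [Finset.sum_add_distrib]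
        exact add_le_add (le_trNorm S he hf) (le_trNorm T he hf)

theorem trNorm_smul_le (c : ℂ) (T : K →L[ℂ] K) : trNorm (c • T) ≤ ‖c‖ₑ * trNorm T := by
  refine trNorm_le fun N e f he hf => ?_
  have : ∑ i, ‖⟪e i, (c • T) (f i)⟫_ℂ‖ₑ = ‖c‖ₑ * ∑ i, ‖⟪e i, T (f i)⟫_ℂ‖ₑ := by
    rw [Finset.mul_sum]
    refine Finset.sum_congr rfl fun i _ => ?_
    rw [smul_apply, inner_smul_right, enorm_mul]
  rw [this]
  gcongr
  exact le_trNorm T he hf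

theorem trNorm_smul (c : ℂ) (T : K →L[ℂ] K) : trNorm (c • T) = ‖c‖ₑ * trNorm T := by
  rcases eq_or_ne c 0 with rfl | hc
  · simp [trNorm_zero]
  refine le_antisymm (trNorm_smul_le c T) ?_
  have h := trNorm_smul_le c⁻¹ (c • T)
  rw [smul_smul, inv_mul_cancel₀ hc, one_smul] at h
  calc ‖c‖ₑ * trNorm T ≤ ‖c‖ₑ * (‖c⁻¹‖ₑ * trNorm (c • T)) := by gcongr
    _ = trNorm (c • T) := by
        rw [← mul_assoc, ← enorm_mul, mul_inv_cancel₀ hc, enorm_one, one_mul]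

theorem enorm_inner_le_trNorm (T : K →L[ℂ] K) {x y : K} (hx : ‖x‖ = 1) (hy : ‖y‖ = 1) :
    ‖⟪x, T y⟫_ℂ‖ₑ ≤ trNorm T := by
  have key : ∀ v : K, ‖v‖ = 1 → Orthonormal ℂ (fun _ : Fin 1 => v) := fun v hv =>
    ⟨fun _ => hv, fun i j hij => absurd (Subsingleton.elim i j) hij⟩
  simpa using le_trNorm T (key x hx) (key y hy)

theorem opNorm_le_trNorm (T : K →L[ℂ] K) (hT : trNorm T ≠ ∞) : ‖T‖ ≤ (trNorm T).toReal := by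
  refine T.opNorm_le_bound ENNReal.toReal_nonneg fun y => ?_
  rcases eq_or_ne y 0 with rfl | hy
  · simp
  rcases eq_or_ne (T y) 0 with hTy | hTy
  · rw [hTy, norm_zero]; positivity
  have hy' : ‖y‖ ≠ 0 := norm_ne_zero_iff.2 hy
  have hT' : ‖T y‖ ≠ 0 := norm_ne_zero_iff.2 hTy
  have h := enorm_inner_le_trNorm T (x := ((‖T y‖ : ℂ)⁻¹) • T y) (y := ((‖y‖ : ℂ)⁻¹) • y)
    (by rw [norm_smul]; simp [hT']) (by rw [norm_smul]; simp [hy'])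
  have h2 := ENNReal.toReal_mono hT h
  rw [toReal_enorm, map_smul, inner_smul_left, inner_smul_right, inner_self_eq_norm_sq_to_K] at h2
  simp only [norm_mul, map_inv₀, norm_inv, norm_pow, Complex.coe_algebraMap, RCLike.norm_conj,
    Complex.norm_real, norm_norm] at h2
  have e : ‖T y‖⁻¹ * (‖y‖⁻¹ * ‖T y‖ ^ 2) = ‖T y‖ / ‖y‖ := by field_simp
  rw [e, div_le_iff₀ (by positivity)] at h2
  exact h2

variable (K) in
/-- The trace-class operators, as a linear subspace of the bounded operators. -/
def traceClassSubmodule : Submodule ℂ (K →L[ℂ] K) where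
  carrier := {T | trNorm T ≠ ∞}
  zero_mem' := by simp [trNorm_zero]
  add_mem' := fun {S T} hS hT =>
    ((trNorm_add_le S T).trans_lt (ENNReal.add_lt_top.2 ⟨hS.lt_top, hT.lt_top⟩)).ne
  smul_mem' := fun c T hT => by
    simp only [Set.mem_ofPred_eq] at hT ⊢
    rw [trNorm_smul]
    exact ENNReal.mul_ne_top enorm_ne_top hT

variable (K) in
/-- The space of trace-class operators on `K`, normed by the trace norm (not by the operator
norm). -/
def TraceClass : Type _ := traceClassSubmodule K

namespace TraceClass

instance : AddCommGroup (TraceClass K) := inferInstanceAs (AddCommGroup (traceClassSubmodule K))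

instance : Module ℂ (TraceClass K) := inferInstanceAs (Module ℂ (traceClassSubmodule K))

/-- The bounded operator underlying a trace-class operator. -/
def toOp (T : TraceClass K) : K →L[ℂ] K := Subtype.val T

theorem toOp_injective : Function.Injective (toOp : TraceClass K → K →L[ℂ] K) :=
  Subtype.val_injective

theorem trNorm_ne_top (T : TraceClass K) : trNorm T.toOp ≠ ∞ := Subtype.property T

theorem toOp_add (S T : TraceClass K) : (S + T).toOp = S.toOp + T.toOp := rfl

theorem toOp_sub (S T : TraceClass K) : (S - T).toOp = S.toOp - T.toOp := rfl

theorem toOp_smul (c : ℂ) (T : TraceClass K) : (c • T).toOp = c • T.toOp := rfl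

instance : Norm (TraceClass K) := ⟨fun T => (trNorm T.toOp).toReal⟩

theorem norm_def (T : TraceClass K) : ‖T‖ = (trNorm T.toOp).toReal := rfl

theorem normedSpaceCore : NormedSpace.Core ℂ (TraceClass K) where
  norm_nonneg _ := ENNReal.toReal_nonneg
  norm_smul c T := by
    rw [norm_def, norm_def, toOp_smul, trNorm_smul, ENNReal.toReal_mul, toReal_enorm]
  norm_triangle S T := by
    rw [norm_def, norm_def, norm_def, toOp_add,
      ← ENNReal.toReal_add S.trNorm_ne_top T.trNorm_ne_top]
    exact ENNReal.toReal_mono (ENNReal.add_ne_top.2 ⟨S.trNorm_ne_top, T.trNorm_ne_top⟩)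
      (trNorm_add_le _ _)
  norm_eq_zero_iff T := by
    constructor
    · intro h
      apply toOp_injective
      have h2 := opNorm_le_trNorm T.toOp T.trNorm_ne_top
      rw [norm_def] at h
      rw [h] at h2
      exact norm_le_zero_iff.1 h2
    · rintro rfl
      have : trNorm (0 : TraceClass K).toOp = 0 := trNorm_zero
      rw [norm_def, this, ENNReal.toReal_zero]

instance : NormedAddCommGroup (TraceClass K) := NormedAddCommGroup.ofCore normedSpaceCore

instance : NormedSpace ℂ (TraceClass K) := NormedSpace.ofCore normedSpaceCore

theorem norm_toOp_le (T : TraceClass K) : ‖T.toOp‖ ≤ ‖T‖ :=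
  opNorm_le_trNorm T.toOp T.trNorm_ne_top

/-- The trace-class operators form a Banach space, so that Bochner integrals in this space have
their usual meaning. -/
instance [CompleteSpace K] : CompleteSpace (TraceClass K) := by
  refine Metric.complete_of_cauchySeq_tendsto fun u hu => ?_
  have hop : CauchySeq fun n => (u n).toOp := by
    rw [Metric.cauchySeq_iff] at hu ⊢
    intro ε hε
    obtain ⟨N, hN⟩ := hu ε hε
    refine ⟨N, fun m hm n hn => lt_of_le_of_lt ?_ (hN m hm n hn)⟩
    rw [dist_eq_norm, dist_eq_norm, ← toOp_sub]
    exact norm_toOp_le _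
  obtain ⟨T, hT⟩ := cauchySeq_tendsto_of_complete hop
  -- the tail estimate, in the limit
  have key : ∀ ε : ℝ, 0 < ε → ∃ N, ∀ m ≥ N, trNorm ((u m).toOp - T) ≤ ENNReal.ofReal ε := by
    intro ε hε
    obtain ⟨N, hN⟩ := Metric.cauchySeq_iff.1 hu ε hε
    refine ⟨N, fun m hm => trNorm_le fun k e f he hf => ?_⟩
    have hlim : Filter.Tendsto
        (fun n => ∑ i, ‖⟪e i, ((u m).toOp - (u n).toOp) (f i)⟫_ℂ‖ₑ) Filter.atTop
        (nhds (∑ i, ‖⟪e i, ((u m).toOp - T) (f i)⟫_ℂ‖ₑ)) := by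
      refine tendsto_finsetSum _ fun i _ => ?_
      have h1 : Filter.Tendsto (fun n => ((u m).toOp - (u n).toOp) (f i)) Filter.atTop
          (nhds (((u m).toOp - T) (f i))) :=
        ((ContinuousLinearMap.apply ℂ K (f i)).continuous.tendsto _).comp
          (tendsto_const_nhds.sub hT)
      exact (continuous_enorm.tendsto _).comp (tendsto_const_nhds.inner h1)
    refine le_of_tendsto hlim ?_
    filter_upwards [Filter.eventually_ge_atTop N] with n hn
    have h2 := hN m hm n hn
    rw [dist_eq_norm, norm_def] at h2
    refine (le_trNorm ((u m).toOp - (u n).toOp) he hf).trans ?_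
    rw [← toOp_sub, ← ENNReal.ofReal_toReal (u m - u n).trNorm_ne_top]
    exact ENNReal.ofReal_le_ofReal h2.le
  have hTfin : T ∈ traceClassSubmodule K := by
    obtain ⟨N, hN⟩ := key 1 one_pos
    have h1 : (u N).toOp - T ∈ traceClassSubmodule K :=
      ((hN N le_rfl).trans_lt ENNReal.ofReal_lt_top).ne
    have h2 := (traceClassSubmodule K).sub_mem (u N).trNorm_ne_top h1
    simpa using h2
  obtain ⟨T', hT'⟩ : ∃ T' : TraceClass K, T'.toOp = T := ⟨⟨T, hTfin⟩, rfl⟩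
  refine ⟨T', Metric.tendsto_atTop.2 fun ε hε => ?_⟩
  obtain ⟨N, hN⟩ := key (ε / 2) (by positivity)
  refine ⟨N, fun m hm => ?_⟩
  rw [dist_eq_norm, norm_def, toOp_sub, hT']
  refine lt_of_le_of_lt ?_ (half_lt_self hε)
  exact ENNReal.toReal_le_of_le_ofReal (by positivity) (hN m hm)

end TraceClass

variable [CompleteSpace K]

/-- The trace `∑ᵢ ⟨eᵢ, T eᵢ⟩`, computed in a fixed orthonormal basis; for trace-class `T` the sum
converges absolutely and does not depend on the basis. -/
def trace (T : K →L[ℂ] K) : ℂ :=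
  ∑' i, ⟪(exists_hilbertBasis ℂ K).choose_spec.choose i,
    T ((exists_hilbertBasis ℂ K).choose_spec.choose i)⟫_ℂ

/-- Density operators (quantum states): positive trace-class operators of unit trace. -/
structure IsDensity (T : K →L[ℂ] K) : Prop where
  isPositive : T.IsPositive
  trNorm_ne_top : trNorm T ≠ ∞
  trace_eq_one : trace T = 1

end TraceClass

section MeasurementChannel

/-- An ensemble `{π(dx), ρ(x)}` of states on `K`: a probability measure on a standard Borel space
together with a measurable family of density operators (measurable as a map into the Banach
space of trace-class operators). Every standard Borel space is isomorphic to one in `Type`. -/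
structure Ensemble (K : Type*) [NormedAddCommGroup K] [InnerProductSpace ℂ K]
    [CompleteSpace K] where
  X : Type
  [measurableSpace : MeasurableSpace X]
  [standardBorel : StandardBorelSpace X]
  π : Measure X
  [isProb : IsProbabilityMeasure π]
  ρ : X → TraceClass K
  stronglyMeasurable_ρ : StronglyMeasurable ρ
  isDensity_ρ : ∀ x, IsDensity (ρ x).toOp

attribute [instance] Ensemble.measurableSpace Ensemble.standardBorel Ensemble.isProb

variable {K : Type*} [NormedAddCommGroup K] [InnerProductSpace ℂ K] [CompleteSpace K]
variable {Y : Type*} [MeasurableSpace Y]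

/-- The average state of an ensemble, a Bochner integral in the space of trace-class operators. -/
def Ensemble.average (E : Ensemble K) : TraceClass K := ∫ x, E.ρ x ∂E.π

/-- The output probability density `p_ρ(y) = Tr ρ m(y)` of the measurement channel of a POVM with
operator density `m`. -/
def outDensity (m : Y → K →L[ℂ] K) (ρ : K →L[ℂ] K) (y : Y) : ℝ := (trace (ρ * m y)).re

/-- The output differential entropy `-∫ p_ρ log p_ρ dμ ∈ [0, ∞]` of the POVM `m(y) μ(dy)`. It is
used for `0 ≤ m(y) ≤ 1`; then `0 ≤ p_ρ ≤ 1`, so that the integrand is nonnegative. -/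
def outEntropy (m : Y → K →L[ℂ] K) (μ : Measure Y) (ρ : K →L[ℂ] K) : ℝ≥0∞ :=
  ∫⁻ y, ENNReal.ofReal (Real.negMulLog (outDensity m ρ y)) ∂μ

/-- The convex closure of the output differential entropy: the infimum of the average output
entropy over all ensembles with average state `ρ`. -/
def entropyClosure (m : Y → K →L[ℂ] K) (μ : Measure Y) (ρ : K →L[ℂ] K) : ℝ≥0∞ :=
  ⨅ (E : Ensemble K) (_ : E.average.toOp = ρ), ∫⁻ x, outEntropy m μ (E.ρ x).toOp ∂E.π

end MeasurementChannel

section TensorPower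

variable {n : ℕ} {α : Type*} [MeasureSpace α] [SigmaFinite (volume : Measure α)]

variable (α) in
/-- The Hilbert space `L²(α)` of complex square-integrable functions. -/
abbrev L2 : Type _ := Lp ℂ 2 (volume : Measure α)

theorem memLp_tensorVec (f : Fin n → L2 α) :
    MemLp (fun ξ : Fin n → α => ∏ k, f k (ξ k)) 2 volume := by
  have hm : AEStronglyMeasurable (fun ξ : Fin n → α => ∏ k, f k (ξ k)) volume := by
    have := Finset.aestronglyMeasurable_fun_prod (μ := (volume : Measure (Fin n → α)))
      (f := fun k (ξ : Fin n → α) => f k (ξ k)) Finset.univ fun k _ =>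
        (Lp.aestronglyMeasurable (f k)).comp_quasiMeasurePreserving
          (Measure.quasiMeasurePreserving_eval (fun _ : Fin n => (volume : Measure α)) k)
    simpa using this
  rw [memLp_two_iff_integrable_sq_norm hm]
  simp_rw [norm_prod, ← Finset.prod_pow]
  exact Integrable.fintype_prod (μ := fun _ : Fin n => (volume : Measure α))
    (f := fun k x => ‖f k x‖ ^ 2) fun k =>
      (memLp_two_iff_integrable_sq_norm (Lp.aestronglyMeasurable (f k))).1 (Lp.memLp (f k))

/-- The elementary tensor `f₁ ⊗ ⋯ ⊗ fₙ`, the function `ξ ↦ f₁(ξ₁) ⋯ fₙ(ξₙ)`, in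
`L²(α)^{⊗ n} = L²(αⁿ)`. -/
def tensorVec (f : Fin n → L2 α) : L2 (Fin n → α) := (memLp_tensorVec f).toLp _

theorem coeFn_tensorVec (f : Fin n → L2 α) :
    tensorVec f =ᵐ[volume] fun ξ => ∏ k, f k (ξ k) :=
  (memLp_tensorVec f).coeFn_toLp

theorem inner_tensorVec (f g : Fin n → L2 α) :
    ⟪tensorVec f, tensorVec g⟫_ℂ = ∏ k, ⟪f k, g k⟫_ℂ := by
  rw [L2.inner_def]
  simp_rw [L2.inner_def]
  rw [← integral_fintype_prod_volume_eq_prod (fun k x => ⟪f k x, g k x⟫_ℂ)]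
  refine integral_congr_ae ?_
  filter_upwards [coeFn_tensorVec f, coeFn_tensorVec g] with ξ h1 h2
  rw [h1, h2]
  simp only [RCLike.inner_apply, map_prod, Finset.prod_mul_distrib]

open scoped ComplexOrder

theorem sum_gram {ι E : Type*} [NormedAddCommGroup E] [InnerProductSpace ℂ E] (v : ι → E)
    (c : ι →₀ ℂ) :
    (c.sum fun i x => c.sum fun j y => star x * Matrix.gram ℂ v i j * y) =
      ((‖Finsupp.linearCombination ℂ v c‖ ^ 2 : ℝ) : ℂ) := by
  have h := inner_self_eq_norm_sq_to_K (𝕜 := ℂ) (Finsupp.linearCombination ℂ v c)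
  rw [Complex.ofReal_pow]
  refine Eq.trans ?_ h
  simp only [Finsupp.linearCombination_apply, Finsupp.sum, sum_inner, inner_sum, inner_smul_left,
    inner_smul_right, Matrix.gram_apply, Finset.mul_sum]
  rw [Finset.sum_comm]
  refine Finset.sum_congr rfl fun i _ => Finset.sum_congr rfl fun j _ => ?_
  simp only [RCLike.star_def]
  ring

theorem posSemidef_gram' {ι E : Type*} [NormedAddCommGroup E] [InnerProductSpace ℂ E]
    (v : ι → E) : (Matrix.gram ℂ v).PosSemidef := by
  refine ⟨Matrix.isHermitian_gram ℂ v, fun c => ?_⟩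
  rw [sum_gram]
  exact Complex.zero_le_real.2 (sq_nonneg _)

theorem posSemidef_prod_sub {ι σ : Type*} (S : Finset σ) (A B : σ → Matrix ι ι ℂ)
    (hB : ∀ k, (B k).PosSemidef) (hAB : ∀ k, (A k - B k).PosSemidef) :
    (Matrix.of fun a b => ∏ k ∈ S, A k a b).PosSemidef ∧
    (Matrix.of fun a b => ∏ k ∈ S, A k a b - ∏ k ∈ S, B k a b).PosSemidef := by
  classical
  have hA : ∀ k, (A k).PosSemidef := fun k => by simpa using (hAB k).add (hB k)
  induction S using Finset.induction_on with
  | empty =>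
    refine ⟨?_, ?_⟩
    · have h := posSemidef_gram' (fun _ : ι => (1 : ℂ))
      convert h using 1
      ext a b
      simp [Matrix.gram]
    · convert (Matrix.PosSemidef.zero : (0 : Matrix ι ι ℂ).PosSemidef) using 1
      ext a b
      simp
  | insert j S hj ih =>
    obtain ⟨h1, h2⟩ := ih
    refine ⟨?_, ?_⟩
    · have e : (Matrix.of fun a b => ∏ k ∈ insert j S, A k a b) =
          (A j).hadamard (Matrix.of fun a b => ∏ k ∈ S, A k a b) := by
        ext a b
        simp [Finset.prod_insert hj]
      rw [e]
      exact (hA j).hadamard h1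
    · have e : (Matrix.of fun a b => ∏ k ∈ insert j S, A k a b - ∏ k ∈ insert j S, B k a b) =
          (A j - B j).hadamard (Matrix.of fun a b => ∏ k ∈ S, A k a b) +
          (B j).hadamard (Matrix.of fun a b => ∏ k ∈ S, A k a b - ∏ k ∈ S, B k a b) := by
        ext a b
        simp only [Finset.prod_insert hj, Matrix.of_apply, Matrix.add_apply, Matrix.hadamard_apply,
          Matrix.sub_apply]
        ring
      rw [e]
      exact ((hAB j).hadamard h1).add ((hB j).hadamard h2)

theorem norm_linearCombination_tensorVec_le (A : Fin n → L2 α →L[ℂ] L2 α)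
    (c : (Fin n → L2 α) →₀ ℂ) :
    ‖Finsupp.linearCombination ℂ (fun f : Fin n → L2 α => tensorVec fun k => A k (f k)) c‖ ≤
      (∏ k, ‖A k‖) * ‖Finsupp.linearCombination ℂ (tensorVec : (Fin n → L2 α) → _) c‖ := by
  have h := (posSemidef_prod_sub (ι := Fin n → L2 α) Finset.univ
    (fun k => ‖A k‖ ^ 2 • Matrix.gram ℂ (fun f : Fin n → L2 α => f k))
    (fun k => Matrix.gram ℂ (fun f : Fin n → L2 α => A k (f k)))
    (fun k => posSemidef_gram' _) (fun k =>
      Matrix.posSemidef_opNorm_smul_gram_sub_gram (fun f : Fin n → L2 α => f k) (A k))).2.2 c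
  have e : (c.sum fun i x => c.sum fun j y => star x * (Matrix.of fun a b =>
        ∏ k, (‖A k‖ ^ 2 • Matrix.gram ℂ (fun f : Fin n → L2 α => f k)) a b -
        ∏ k, Matrix.gram ℂ (fun f : Fin n → L2 α => A k (f k)) a b) i j * y) =
      (((∏ k, ‖A k‖) ^ 2 * ‖Finsupp.linearCombination ℂ
        (tensorVec : (Fin n → L2 α) → L2 (Fin n → α)) c‖ ^ 2 - ‖Finsupp.linearCombination ℂ
        (fun f : Fin n → L2 α => tensorVec fun k => A k (f k)) c‖ ^ 2 : ℝ) : ℂ) := by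
    rw [Complex.ofReal_sub, Complex.ofReal_mul, ← sum_gram, ← sum_gram]
    simp only [Finsupp.sum, Finset.mul_sum, ← Finset.sum_sub_distrib, Matrix.gram_apply,
      inner_tensorVec, Matrix.of_apply, Matrix.smul_apply, Complex.real_smul,
      Finset.prod_mul_distrib]
    refine Finset.sum_congr rfl fun i _ => Finset.sum_congr rfl fun j _ => ?_
    push_cast
    rw [Finset.prod_pow]
    ring
  rw [e] at h
  have h' := Complex.zero_le_real.1 h
  rw [sub_nonneg, ← mul_pow] at h'
  exact (pow_le_pow_iff_left₀ (norm_nonneg _) (by positivity) two_ne_zero).1 h'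

theorem setIntegral_box_eq_zero (g : L2 (Fin n → α))
    (hg : ∀ f : Fin n → L2 α, ⟪tensorVec f, g⟫_ℂ = 0) (t : Fin n → Set α)
    (ht : ∀ k, MeasurableSet (t k)) (ht' : ∀ k, volume (t k) ≠ ∞) :
    ∫ ξ in Set.univ.pi t, g ξ = 0 := by
  have h := hg fun k => indicatorConstLp 2 (ht k) (ht' k) (1 : ℂ)
  rw [L2.inner_def] at h
  rw [← integral_indicator (MeasurableSet.univ_pi ht), ← h]
  refine integral_congr_ae ?_
  have h1 : ∀ᵐ ξ : Fin n → α, ∀ k,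
      (indicatorConstLp 2 (ht k) (ht' k) (1 : ℂ) : L2 α) (ξ k) =
        (t k).indicator (fun _ => (1 : ℂ)) (ξ k) := by
    rw [ae_all_iff]
    intro k
    exact (Measure.quasiMeasurePreserving_eval (fun _ : Fin n => (volume : Measure α)) k).ae
      (indicatorConstLp_coeFn (hs := ht k) (hμs := ht' k) (c := (1 : ℂ)))
  filter_upwards [h1, coeFn_tensorVec fun k => indicatorConstLp 2 (ht k) (ht' k) (1 : ℂ)]
    with ξ h2 h3
  rw [h3]
  simp only [h2, RCLike.inner_apply]
  by_cases hξ : ξ ∈ Set.univ.pi t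
  · rw [Set.indicator_of_mem hξ, Finset.prod_eq_one, map_one, mul_one]
    intro k _
    exact Set.indicator_of_mem (hξ k trivial) _
  · rw [Set.indicator_of_notMem hξ]
    obtain ⟨k, hk⟩ : ∃ k, ξ k ∉ t k := by
      by_contra hcon
      push Not at hcon
      exact hξ fun k _ => hcon k
    rw [Finset.prod_eq_zero (Finset.mem_univ k) (Set.indicator_of_notMem hk _), map_zero,
      mul_zero]

theorem eq_zero_of_inner_tensorVec (g : L2 (Fin n → α))
    (hg : ∀ f : Fin n → L2 α, ⟪tensorVec f, g⟫_ℂ = 0) : g = 0 := by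
  let B : ℕ → Set (Fin n → α) := fun N => Set.univ.pi fun _ => spanningSets volume N
  have hBm : ∀ N, MeasurableSet (B N) := fun N =>
    MeasurableSet.univ_pi fun _ => measurableSet_spanningSets _ _
  have hBf : ∀ N, volume (B N) ≠ ∞ := fun N => by
    rw [volume_pi_pi]
    exact ENNReal.prod_ne_top fun _ _ => (measure_spanningSets_lt_top _ _).ne
  have hgi : ∀ N, Integrable g (volume.restrict (B N)) := fun N =>
    integrableOn_Lp_of_measure_ne_top g fact_one_le_two_ennreal.elim (hBf N)
  have hint : ∀ N (S : Set (Fin n → α)), MeasurableSet S →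
      ∫ ξ in S, g ξ ∂(volume.restrict (B N)) = 0 := by
    intro N S hS
    have hunivB : ∫ ξ, g ξ ∂(volume.restrict (B N)) = 0 :=
      setIntegral_box_eq_zero g hg _ (fun _ => measurableSet_spanningSets _ _)
        fun _ => (measure_spanningSets_lt_top _ _).ne
    induction S, hS using MeasurableSpace.induction_on_inter
      (generateFrom_pi (α := fun _ : Fin n => α)).symm isPiSystem_pi with
    | empty => simp
    | basic t ht =>
      obtain ⟨t, ht, rfl⟩ := ht
      rw [Measure.restrict_restrict (MeasurableSet.univ_pi fun k => ht k trivial),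
        ← Set.pi_inter_distrib]
      exact setIntegral_box_eq_zero g hg _
        (fun k => (ht k trivial).inter (measurableSet_spanningSets _ _))
        fun k => measure_ne_top_of_subset Set.inter_subset_right
          (measure_spanningSets_lt_top _ _).ne
    | compl t ht ih =>
      have := integral_add_compl ht (hgi N)
      rw [ih, hunivB, zero_add] at this
      exact this
    | iUnion t hd ht ih =>
      rw [integral_iUnion ht hd (hgi N).integrableOn]
      simp [ih]
  have hz : ∀ N, ∀ᵐ ξ ∂(volume.restrict (B N)), g ξ = 0 := fun N =>
    (hgi N).ae_eq_zero_of_forall_setIntegral_eq_zero fun S hS _ => hint N S hS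
  have hU : ⋃ N, B N = Set.univ := by
    simp only [B]
    rw [Set.iUnion_univ_pi_of_monotone fun _ => monotone_spanningSets volume]
    simp [iUnion_spanningSets]
  rw [Lp.eq_zero_iff_ae_eq_zero]
  have := (ae_restrict_iUnion_iff B (fun ξ => g ξ = 0)).2 hz
  rwa [hU, Measure.restrict_univ] at this

theorem denseRange_tensorVec :
    DenseRange (Finsupp.linearCombination ℂ (tensorVec : (Fin n → L2 α) → L2 (Fin n → α))) := by
  have h : (LinearMap.range (Finsupp.linearCombination ℂ
      (tensorVec : (Fin n → L2 α) → L2 (Fin n → α)))).topologicalClosure = ⊤ := by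
    rw [Submodule.topologicalClosure_eq_top_iff, Submodule.eq_bot_iff]
    intro g hg
    refine eq_zero_of_inner_tensorVec g fun f => ?_
    exact (Submodule.mem_orthogonal _ g).1 hg _ ⟨Finsupp.single f 1, by simp⟩
  have := Submodule.dense_iff_topologicalClosure_eq_top.2 h
  rwa [LinearMap.coe_range] at this

/-- The operator `A₁ ⊗ ⋯ ⊗ Aₙ` on `L²(α)^{⊗ n}`, the bounded operator given on elementary tensors
by `f₁ ⊗ ⋯ ⊗ fₙ ↦ A₁ f₁ ⊗ ⋯ ⊗ Aₙ fₙ`; see `tensorOp_tensorVec`. -/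
def tensorOp (A : Fin n → L2 α →L[ℂ] L2 α) : L2 (Fin n → α) →L[ℂ] L2 (Fin n → α) :=
  (Finsupp.linearCombination ℂ
    (fun f : Fin n → L2 α => tensorVec fun k => A k (f k))).extendOfNorm
      (Finsupp.linearCombination ℂ (tensorVec : (Fin n → L2 α) → L2 (Fin n → α)))

theorem tensorOp_tensorVec (A : Fin n → L2 α →L[ℂ] L2 α) (f : Fin n → L2 α) :
    tensorOp A (tensorVec f) = tensorVec fun k => A k (f k) := by
  have h := LinearMap.extendOfNorm_eq (f := Finsupp.linearCombination ℂ
      (fun f : Fin n → L2 α => tensorVec fun k => A k (f k))) denseRange_tensorVec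
    ⟨_, norm_linearCombination_tensorVec_le A⟩ (Finsupp.single f 1)
  simpa [tensorOp] using h

end TensorPower

section Bosonic

variable {s n : ℕ}

/-- The phase space `ℝ^{2s}` of `s` modes, with coordinates `z = [x₁, y₁, …, xₛ, yₛ]`:
`xⱼ = z (j, 0)` and `yⱼ = z (j, 1)`. -/
abbrev Phase (s : ℕ) : Type := Fin s × Fin 2 → ℝ

/-- The Hilbert space `L²(ℝˢ)` of `s` bosonic modes in the Schrödinger representation, where
`qⱼ` is multiplication by the coordinate `ξⱼ` and `pⱼ = -i ∂/∂ξⱼ`. -/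
abbrev ModeSpace (s : ℕ) : Type := L2 (Fin s → ℝ)

/-- The Hilbert space `L²(ℝˢ)^{⊗ n} = L²((ℝˢ)ⁿ)` of `n` copies of the system. -/
abbrev CopySpace (s n : ℕ) : Type := L2 (Fin n → Fin s → ℝ)

/-- The unimodular factor `ξ ↦ exp (i ∑ⱼ yⱼ (ξⱼ - xⱼ / 2))`. -/
def phaseFactor (z : Phase s) (ξ : Fin s → ℝ) : ℂ :=
  Complex.exp (((∑ j, z (j, 1) * (ξ j - z (j, 0) / 2) : ℝ) : ℂ) * Complex.I)

theorem norm_phaseFactor (z : Phase s) (ξ : Fin s → ℝ) : ‖phaseFactor z ξ‖ = 1 :=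
  Complex.norm_exp_ofReal_mul_I _

theorem continuous_phaseFactor (z : Phase s) : Continuous (phaseFactor z) := by
  unfold phaseFactor
  fun_prop

theorem measurePreserving_shift (z : Phase s) :
    MeasurePreserving (fun ξ : Fin s → ℝ => ξ - fun j => z (j, 0)) volume volume :=
  measurePreserving_sub_right volume _

theorem memLp_displacement (z : Phase s) (ψ : ModeSpace s) :
    MemLp (fun ξ => phaseFactor z ξ * ψ (ξ - fun j => z (j, 0))) 2 volume := by
  have h := (Lp.memLp ψ).comp_measurePreserving (measurePreserving_shift z)
  refine h.of_le ((continuous_phaseFactor z).aestronglyMeasurable.mul h.1) ?_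
  filter_upwards with ξ
  rw [norm_mul, norm_phaseFactor, one_mul]
  rfl

theorem displacement_congr (z : Phase s) {f g : (Fin s → ℝ) → ℂ} (h : f =ᵐ[volume] g) :
    (fun ξ => phaseFactor z ξ * f (ξ - fun j => z (j, 0))) =ᵐ[volume]
      fun ξ => phaseFactor z ξ * g (ξ - fun j => z (j, 0)) := by
  filter_upwards [(measurePreserving_shift z).quasiMeasurePreserving.ae h] with ξ hξ
  rw [hξ]

/-- The displacement operator `D(z) = exp i ∑ⱼ (yⱼ qⱼ - xⱼ pⱼ)`, which acts in the Schrödinger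
representation by `(D(z) ψ)(ξ) = exp (i ∑ⱼ yⱼ (ξⱼ - xⱼ / 2)) ψ(ξ - x)`. -/
def displacement (z : Phase s) : ModeSpace s →L[ℂ] ModeSpace s :=
  LinearIsometry.toContinuousLinearMap
    { toFun := fun ψ => (memLp_displacement z ψ).toLp _
      map_add' := fun ψ φ => by
        rw [← MemLp.toLp_add]
        refine MemLp.toLp_congr _ _ ?_
        filter_upwards [displacement_congr z (Lp.coeFn_add ψ φ)] with ξ h
        rw [h]
        simp only [Pi.add_apply, mul_add]
      map_smul' := fun c ψ => by
        rw [RingHom.id_apply, ← MemLp.toLp_const_smul]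
        refine MemLp.toLp_congr _ _ ?_
        filter_upwards [displacement_congr z (Lp.coeFn_smul c ψ)] with ξ h
        rw [h]
        simp only [Pi.smul_apply, smul_eq_mul]
        ring
      norm_map' := fun ψ => by
        have h := eLpNorm_comp_measurePreserving (p := 2) (Lp.aestronglyMeasurable ψ)
          (measurePreserving_shift z)
        change ‖(memLp_displacement z ψ).toLp _‖ = ‖ψ‖
        rw [Lp.norm_toLp, Lp.norm_def, ← h]
        refine congrArg ENNReal.toReal (eLpNorm_congr_norm_ae ?_)
        filter_upwards with ξ
        rw [norm_mul, norm_phaseFactor, one_mul]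
        rfl }

theorem coeFn_displacement (z : Phase s) (ψ : ModeSpace s) :
    displacement z ψ =ᵐ[volume] fun ξ => phaseFactor z ξ * ψ (ξ - fun j => z (j, 0)) :=
  (memLp_displacement z ψ).coeFn_toLp

/-- The vector `w = [y₁, -x₁, …, yₛ, -xₛ]`, for which `D(z) = exp (i R w)` with
`R = [q₁, p₁, …, qₛ, pₛ]`. -/
def weylVec (z : Phase s) : Phase s := fun a => if a.2 = 0 then z (a.1, 1) else -z (a.1, 0)

/-- `ρ` is the centered Gaussian density operator with covariance matrix `β` (rows and columns
in the order of `R = [q₁, p₁, …, qₛ, pₛ]`): its quantum characteristic function is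
`Tr ρ exp (i R w) = exp (-wᵗ β w / 2)`. -/
structure IsCenteredGaussian (β : Matrix (Fin s × Fin 2) (Fin s × Fin 2) ℝ)
    (ρ : ModeSpace s →L[ℂ] ModeSpace s) : Prop where
  isSymm : β.IsSymm
  isDensity : IsDensity ρ
  charFun_eq : ∀ z : Phase s, trace (ρ * displacement z) =
    Complex.exp ((-(weylVec z ⬝ᵥ β.mulVec (weylVec z)) / 2 : ℝ) : ℂ)

/-- The operator density `m(z) = D(z) ρ D(z)*` of the approximate position-momentum measurement. -/
def povmDensity (ρ : ModeSpace s →L[ℂ] ModeSpace s) (z : Phase s) :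
    ModeSpace s →L[ℂ] ModeSpace s :=
  displacement z * ρ * star (displacement z)

/-- The reference measure `μ(dz) = d^{2s}z / (2π)ˢ`. -/
def refMeasure (s : ℕ) : Measure (Phase s) :=
  ENNReal.ofReal (((2 * Real.pi) ^ s)⁻¹) • volume

/-- The displacement operator `D(z̃) = D(z⁽¹⁾) ⊗ ⋯ ⊗ D(z⁽ⁿ⁾)` of `n` copies. -/
def copyDisplacement (z : Fin n → Phase s) : CopySpace s n →L[ℂ] CopySpace s n :=
  tensorOp fun k => displacement (z k)

/-- The operator density `m̃(z̃) = m(z⁽¹⁾) ⊗ ⋯ ⊗ m(z⁽ⁿ⁾)` of `M^{⊗ n}`. -/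
def copyPovmDensity (ρ : ModeSpace s →L[ℂ] ModeSpace s) (z : Fin n → Phase s) :
    CopySpace s n →L[ℂ] CopySpace s n :=
  tensorOp fun k => povmDensity ρ (z k)

/-- The reference measure `μ(dz⁽¹⁾) ⋯ μ(dz⁽ⁿ⁾)` of `M^{⊗ n}`. -/
def copyRefMeasure (s n : ℕ) : Measure (Fin n → Phase s) := Measure.pi fun _ => refMeasure s

/-- The functional `e_{M^{⊗ n}}` for the measurement `M(dz) = D(z) ρ D(z)* d^{2s}z / (2π)ˢ`. -/
def copyEntropyClosure (n : ℕ) (ρ : ModeSpace s →L[ℂ] ModeSpace s)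
    (σ : CopySpace s n →L[ℂ] CopySpace s n) : ℝ≥0∞ :=
  entropyClosure (copyPovmDensity (n := n) ρ) (copyRefMeasure s n) σ

/-- The action `(O z̃)⁽ᵏ⁾ = ∑ₗ O_{kl} z⁽ˡ⁾` of an `n × n` matrix on the phase space of `n` copies. -/
def mixCopies (O : Matrix (Fin n) (Fin n) ℝ) (z : Fin n → Phase s) : Fin n → Phase s :=
  fun k => ∑ l, O k l • z l

/-- The unitary `U` implements the linear transformation `R̃ = [R⁽¹⁾, …, R⁽ⁿ⁾] ↦ R̃ O` of the
canonical observables of `n` copies, expressed by its action `U* D(z̃) U = D(O z̃)` on the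
displacement operators. -/
def Implements (U : unitary (CopySpace s n →L[ℂ] CopySpace s n))
    (O : Matrix (Fin n) (Fin n) ℝ) : Prop :=
  ∀ z : Fin n → Phase s,
    star (U : CopySpace s n →L[ℂ] CopySpace s n) * copyDisplacement z * U =
      copyDisplacement (mixCopies O z)

end Bosonic

end QMeas

end

open MeasureTheory
open scoped ENNReal InnerProductSpace

noncomputable section

/-! Everything rests on one invariance: a bilinear form summed over the copies does not change when
an orthogonal matrix mixes them (`sum_mix_mix`). Existence of `U`: substitution, `(Uψ)(ξ) = ψ(Oξ)`,
is unitary because `O` preserves Lebesgue measure, and it carries `D(Oz)` to `D(z)` because the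
phase of `D(z)` is a sum over the copies of dot products. Invariance of the Gaussian state: the
characteristic function of `ρβ^{⊗n}` at `z` is the exponential of `-½ ∑ₖ wₖᵗ β wₖ`, hence is
unchanged by `z ↦ Oz`. Thus `U ρβ^{⊗n} U*` and `ρβ^{⊗n}` have the same characteristic function, and
they coincide because displacement operators separate trace-class operators
(`tsum_inner_mul_inner_eq_zero`). That separation is a Fourier inversion in the momentum variable
followed by an integration over all shifts of position. Entropy: since `m̃(z) = D(z) ρβ^{⊗n} D(z)*`,
conjugation gives `U* m̃(z) U = m̃(Oz)`. Hence the output density of `UρU*` is that of `ρ` composed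
with `O`, which preserves the reference measure, so both states have the same output entropy.
Conjugating ensembles gives `e(UρU*) ≤ e(ρ)` (`entropyClosure_conj_le`); the same inequality for
`U*` and `Oᵗ` is the converse. Traces are handled by writing a state as `∑ |uᵢ⟩⟨uᵢ|` with `∑ ‖uᵢ‖² <
∞`. This makes them independent of the basis, compatible with tensor powers, and accessible to
Fubini. -/

namespace QMeas

/-! ### Positive trace-class operators as sums of rank-one operators; the trace -/

section RankOneSum

variable {K : Type*} [NormedAddCommGroup K] [InnerProductSpace ℂ K]

/-- `T = ∑ᵢ |uᵢ⟩⟨uᵢ|` weakly, with `∑ᵢ ‖uᵢ‖² < ∞`. -/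
structure IsRankOneSum {ι : Type*} (u : ι → K) (T : K →L[ℂ] K) : Prop where
  summable : Summable fun i => ‖u i‖ ^ 2
  hasSum : ∀ f g, HasSum (fun i => ⟪f, u i⟫_ℂ * ⟪u i, g⟫_ℂ) ⟪f, T g⟫_ℂ

variable {ι : Type*} {u : ι → K} {T : K →L[ℂ] K}

theorem summable_mul_of_sq {f g : ι → ℝ} (hf : Summable fun i => f i ^ 2)
    (hg : Summable fun i => g i ^ 2) (hf0 : ∀ i, 0 ≤ f i) (hg0 : ∀ i, 0 ≤ g i) :
    Summable fun i => f i * g i :=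
  Summable.of_nonneg_of_le (fun i => mul_nonneg (hf0 i) (hg0 i))
    (fun i => by nlinarith [sq_nonneg (f i - g i), sq_nonneg (f i), sq_nonneg (g i)]) (hf.add hg)

theorem hasSum_sq_norm_inner_basis {κ : Type*} (e : HilbertBasis κ ℂ K) (v : K) :
    HasSum (fun j => ‖⟪v, e j⟫_ℂ‖ ^ 2) (‖v‖ ^ 2) := by
  have h := (e.hasSum_inner_mul_inner v v).map Complex.reCLM Complex.reCLM.continuous
  convert h using 1
  · funext j
    refine Eq.trans ?_ (inner_mul_symm_re_eq_norm (𝕜 := ℂ) v (e j)).symm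
    rw [norm_mul, norm_inner_symm (e j) v, sq]
  · rw [Complex.reCLM_apply, inner_self_eq_norm_sq_to_K]
    norm_cast

theorem IsRankOneSum.summable_inner (h : IsRankOneSum u T) (B : K →L[ℂ] K) :
    Summable fun i => ‖⟪u i, B (u i)⟫_ℂ‖ := by
  refine Summable.of_nonneg_of_le (fun i => norm_nonneg _) (fun i => ?_) (h.summable.mul_left ‖B‖)
  calc ‖⟪u i, B (u i)⟫_ℂ‖ ≤ ‖u i‖ * ‖B (u i)‖ := norm_inner_le_norm _ _
    _ ≤ ‖u i‖ * (‖B‖ * ‖u i‖) := by gcongr; exact B.le_opNorm _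
    _ = _ := by ring

variable [CompleteSpace K]

theorem IsRankOneSum.conj (h : IsRankOneSum u T) (V : K →L[ℂ] K) :
    IsRankOneSum (fun i => V (u i)) (V * T * star V) where
  summable := by
    refine Summable.of_nonneg_of_le (fun i => sq_nonneg _) (fun i => ?_)
      (h.summable.mul_left (‖V‖ ^ 2))
    rw [← mul_pow]
    exact pow_le_pow_left₀ (norm_nonneg _) (V.le_opNorm _) 2
  hasSum f g := by
    have := h.hasSum (star V f) (star V g)
    simpa only [ContinuousLinearMap.star_eq_adjoint, ContinuousLinearMap.adjoint_inner_left,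
      ContinuousLinearMap.adjoint_inner_right, mul_apply_eq_comp] using this

/-- The double family `⟨B* uᵢ, eⱼ⟩⟨eⱼ, uᵢ⟩` is absolutely summable, both factors being
square-summable over pairs. Summing first over `j` gives `⟨uᵢ, B uᵢ⟩` by Parseval; summing first
over `i` gives the diagonal entries of `TB`. -/
theorem IsRankOneSum.hasSum_inner_basis (h : IsRankOneSum u T) (B : K →L[ℂ] K) {κ : Type*}
    (e : HilbertBasis κ ℂ K) :
    HasSum (fun j => ⟪e j, T (B (e j))⟫_ℂ) (∑' i, ⟪u i, B (u i)⟫_ℂ) := by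
  let F : ι × κ → ℂ := fun p => ⟪star B (u p.1), e p.2⟫_ℂ * ⟪e p.2, u p.1⟫_ℂ
  have hsq : ∀ V : K →L[ℂ] K, Summable fun p : ι × κ => ‖⟪V (u p.1), e p.2⟫_ℂ‖ ^ 2 := by
    intro V
    refine (summable_prod_of_nonneg fun p => sq_nonneg _).2
      ⟨fun i => (hasSum_sq_norm_inner_basis e (V (u i))).summable, ?_⟩
    refine (h.conj V).summable.congr fun i => ?_
    exact (hasSum_sq_norm_inner_basis e (V (u i))).tsum_eq.symm
  have hF : Summable F := by
    refine Summable.of_norm ?_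
    simp only [F, norm_mul]
    refine summable_mul_of_sq (hsq (star B)) ((hsq 1).congr fun p => ?_)
      (fun _ => norm_nonneg _) fun _ => norm_nonneg _
    rw [norm_inner_symm]
    rfl
  have hrow : ∀ i, HasSum (fun j => F (i, j)) ⟪u i, B (u i)⟫_ℂ := fun i => by
    have := e.hasSum_inner_mul_inner (star B (u i)) (u i)
    rwa [ContinuousLinearMap.star_eq_adjoint, ContinuousLinearMap.adjoint_inner_left] at this
  have hcol : ∀ j, HasSum (fun i => F (i, j)) ⟪e j, T (B (e j))⟫_ℂ := fun j => by
    convert h.hasSum (e j) (B (e j)) using 2 with i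
    simp only [F]
    rw [ContinuousLinearMap.star_eq_adjoint, ContinuousLinearMap.adjoint_inner_left, mul_comm]
  rw [(hF.hasSum.prod_fiberwise hrow).tsum_eq]
  exact ((Equiv.prodComm κ ι).hasSum_iff.2 hF.hasSum).prod_fiberwise hcol

/-- Frees the trace from the basis chosen in its definition; later trace computations go through
this formula. -/
theorem IsRankOneSum.trace_mul (h : IsRankOneSum u T) (B : K →L[ℂ] K) :
    trace (T * B) = ∑' i, ⟪u i, B (u i)⟫_ℂ :=
  (h.hasSum_inner_basis B _).tsum_eq

theorem IsDensity.summable_basis (hT : IsDensity T) {κ : Type*} (e : HilbertBasis κ ℂ K) :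
    Summable fun j => ‖⟪e j, T (e j)⟫_ℂ‖ := by
  refine summable_of_sum_le (c := (trNorm T).toReal) (fun _ => norm_nonneg _) fun S => ?_
  have ho : Orthonormal ℂ fun k : Fin S.card => e (S.equivFin.symm k) :=
    e.orthonormal.comp _ (Subtype.val_injective.comp S.equivFin.symm.injective)
  have h := ENNReal.toReal_mono hT.trNorm_ne_top (le_trNorm T ho ho)
  rw [ENNReal.toReal_sum fun _ _ => enorm_ne_top] at h
  simp only [toReal_enorm] at h
  rw [S.equivFin.symm.sum_comp (fun j : S => ‖⟪e j, T (e j)⟫_ℂ‖),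
    Finset.sum_coe_sort S (fun j => ‖⟪e j, T (e j)⟫_ℂ‖)] at h
  exact h

/-- Take `uⱼ = √T eⱼ` for a Hilbert basis `e`; then `∑ ‖uⱼ‖²` is the sum of the diagonal entries of
`T`, which the trace norm bounds. -/
theorem IsDensity.exists_isRankOneSum {K : Type} [NormedAddCommGroup K] [InnerProductSpace ℂ K]
    [CompleteSpace K] {T : K →L[ℂ] K} (hT : IsDensity T) :
    ∃ (ι : Type) (_ : Countable ι) (u : ι → K), IsRankOneSum u T := by
  obtain ⟨w, e, -⟩ := exists_hilbertBasis ℂ K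
  have hT0 : 0 ≤ T := (ContinuousLinearMap.nonneg_iff_isPositive T).2 hT.isPositive
  let R := CFC.sqrt T
  have hRR : R * R = T := CFC.sqrt_mul_sqrt_self T
  have hR : star R = R := (CFC.sqrt_nonneg T).isSelfAdjoint
  have hin : ∀ f g, ⟪f, T g⟫_ℂ = ⟪R f, R g⟫_ℂ := fun f g => by
    rw [← hRR, mul_apply_eq_comp, ← ContinuousLinearMap.adjoint_inner_left,
      ← ContinuousLinearMap.star_eq_adjoint, hR]
  have hsum : Summable fun j => ‖R (e j)‖ ^ 2 := by
    refine (hT.summable_basis e).congr fun j => ?_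
    rw [hin, inner_self_eq_norm_sq_to_K]
    simp
  have hfg : ∀ f g, HasSum (fun j => ⟪f, R (e j)⟫_ℂ * ⟪R (e j), g⟫_ℂ) ⟪f, T g⟫_ℂ := fun f g => by
    have hs : ∀ v w, ⟪R v, w⟫_ℂ = ⟪v, R w⟫_ℂ := fun v w => by
      rw [← ContinuousLinearMap.adjoint_inner_left, ← ContinuousLinearMap.star_eq_adjoint, hR]
    have := e.hasSum_inner_mul_inner (R f) (R g)
    rw [← hin] at this
    simpa only [hs] using this
  -- Only countably many `uⱼ` are nonzero. Discarding the others gives a countable index set, as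
  -- exchanging sums and integrals will require, without assuming `K` separable.
  let S := Function.support fun j => ‖R (e j)‖ ^ 2
  refine ⟨S, hsum.countable_support.to_subtype, fun j => R (e j), hsum.subtype S, fun f g => ?_⟩
  refine (hasSum_subtype_iff_of_support_subset (s := S) fun j hj => ?_).2 (hfg f g)
  contrapose! hj
  have : R (e j) = 0 := by simpa [S] using hj
  simp [this]

end RankOneSum

/-! ### Tensor products of operators and of rank-one sums -/

section TensorOperators

theorem hasSum_mul_of_norm {ι κ : Type*} {a : ι → ℂ} {b : κ → ℂ} {t : ℂ}
    (ha : Summable fun i => ‖a i‖) (hb : Summable fun j => ‖b j‖) (ht : HasSum b t) :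
    HasSum (fun p : ι × κ => a p.1 * b p.2) ((∑' i, a i) * t) := by
  have h : Summable fun p : ι × κ => ‖a p.1 * b p.2‖ := by
    simpa only [norm_mul] using
      ha.mul_of_nonneg hb (fun _ => norm_nonneg _) fun _ => norm_nonneg _
  exact ha.of_norm.hasSum.mul ht h.of_norm

/-- Distributivity of a finite product over absolutely convergent series, by splitting off the first
factor. Norm summability is part of the conclusion because the induction needs it. -/
theorem hasSum_prod_pi {ι : Type*} {n : ℕ} (f : Fin n → ι → ℂ)
    (hf : ∀ k, Summable fun i => ‖f k i‖) :
    (Summable fun I : Fin n → ι => ‖∏ k, f k (I k)‖) ∧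
      HasSum (fun I : Fin n → ι => ∏ k, f k (I k)) (∏ k, ∑' i, f k i) := by
  induction n with
  | zero =>
    have h : HasSum (fun I : Fin 0 → ι => ∏ k, f k (I k)) 1 := by simp
    exact ⟨h.summable.norm, by simp⟩
  | succ n ih =>
    obtain ⟨h1, h2⟩ := ih (fun k => f k.succ) fun k => hf k.succ
    let c : ι × (Fin n → ι) ≃ (Fin (n + 1) → ι) := Fin.consEquiv fun _ => ι
    have hc : ∀ p, ∏ k, f k (c p k) = f 0 p.1 * ∏ k : Fin n, f k.succ (p.2 k) := fun p => by
      rw [Fin.prod_univ_succ]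
      rfl
    have h4 := hasSum_mul_of_norm (hf 0) h1 h2
    have h5 : HasSum (fun I : Fin (n + 1) → ι => ∏ k, f k (I k)) (∏ k, ∑' i, f k i) := by
      rw [Fin.prod_univ_succ]
      refine c.hasSum_iff.1 ?_
      rwa [show (fun I : Fin (n + 1) → ι => ∏ k, f k (I k)) ∘ c = _ from funext hc]
    exact ⟨h5.summable.norm, h5⟩

variable {n : ℕ} {α : Type*} [MeasureSpace α] [SigmaFinite (volume : Measure α)]

theorem clm_ext_tensorVec {E : Type*} [NormedAddCommGroup E] [NormedSpace ℂ E]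
    {A B : L2 (Fin n → α) →L[ℂ] E} (h : ∀ f, A (tensorVec f) = B (tensorVec f)) : A = B := by
  have := denseRange_tensorVec (n := n) (α := α) |>.equalizer A.continuous B.continuous
  refine DFunLike.coe_injective (this ?_)
  funext c
  simp only [Function.comp_apply, Finsupp.linearCombination_apply, Finsupp.sum, map_sum, map_smul,
    h]

theorem eq_of_inner_tensorVec {g g' : L2 (Fin n → α)}
    (h : ∀ f : Fin n → L2 α, ⟪tensorVec f, g⟫_ℂ = ⟪tensorVec f, g'⟫_ℂ) : g = g' :=
  sub_eq_zero.1 <| eq_zero_of_inner_tensorVec _ fun f => by rw [inner_sub_right, h f, sub_self]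

theorem tensorOp_mul (A B : Fin n → L2 α →L[ℂ] L2 α) :
    tensorOp (fun k => A k * B k) = tensorOp A * tensorOp B :=
  clm_ext_tensorVec fun f => by
    simp only [mul_apply_eq_comp, tensorOp_tensorVec]

theorem star_tensorOp (A : Fin n → L2 α →L[ℂ] L2 α) :
    star (tensorOp A) = tensorOp fun k => star (A k) :=
  clm_ext_tensorVec fun f => eq_of_inner_tensorVec fun g => by
    simp only [ContinuousLinearMap.star_eq_adjoint, ContinuousLinearMap.adjoint_inner_right,
      tensorOp_tensorVec, inner_tensorVec]

theorem norm_tensorVec_sq (f : Fin n → L2 α) : ‖tensorVec f‖ ^ 2 = ∏ k, ‖f k‖ ^ 2 := by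
  have h := inner_tensorVec f f
  simp only [inner_self_eq_norm_sq_to_K] at h
  exact_mod_cast h

/-- The rank-one operators of the multi-indexed vectors have summable norms, so their sum converges
in operator norm to a bounded operator. On elementary tensors it factors into the weak sums for `T`,
hence equals `T ⊗ ⋯ ⊗ T` there, and by density everywhere. -/
theorem IsRankOneSum.tensorOp {ι : Type*} {u : ι → L2 α} {T : L2 α →L[ℂ] L2 α}
    (h : IsRankOneSum u T) :
    IsRankOneSum (fun I : Fin n → ι => tensorVec fun k => u (I k)) (tensorOp fun _ => T) := by
  have hs : Summable fun I : Fin n → ι => ‖tensorVec fun k => u (I k)‖ ^ 2 := by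
    refine (hasSum_prod_pi (fun (_ : Fin n) i => ((‖u i‖ ^ 2 : ℝ) : ℂ)) fun k => ?_).1.congr
      fun I => ?_
    · simpa using h.summable
    · rw [norm_tensorVec_sq, norm_prod]
      simp
  let Q : (Fin n → ι) → L2 (Fin n → α) →L[ℂ] L2 (Fin n → α) := fun I =>
    InnerProductSpace.rankOne ℂ (tensorVec fun k => u (I k)) (tensorVec fun k => u (I k))
  have hQ : Summable Q := by
    refine Summable.of_norm (hs.congr fun I => ?_)
    simp only [Q, InnerProductSpace.norm_rankOne, sq]
  have hK : ∀ f g, HasSum (fun I : Fin n → ι => ⟪f, tensorVec fun k => u (I k)⟫_ℂ *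
      ⟪tensorVec fun k => u (I k), g⟫_ℂ) ⟪f, (∑' I, Q I) g⟫_ℂ := fun f g => by
    have h1 := (hQ.hasSum.mapL (ContinuousLinearMap.apply ℂ _ g)).mapL (innerSL ℂ f)
    simpa [Q, inner_smul_right, mul_comm] using h1
  have hT : ∑' I, Q I = QMeas.tensorOp fun _ => T :=
    clm_ext_tensorVec fun g => eq_of_inner_tensorVec fun f => by
      refine (hK _ _).unique ?_
      simp only [tensorOp_tensorVec, inner_tensorVec, ← Finset.prod_mul_distrib]
      have h2 := (hasSum_prod_pi (fun k i => ⟪f k, u i⟫_ℂ * ⟪u i, g k⟫_ℂ) fun k =>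
        (h.hasSum (f k) (g k)).summable.norm).2
      simpa only [fun k => (h.hasSum (f k) (g k)).tsum_eq] using h2
  exact ⟨hs, fun f g => hT ▸ hK f g⟩

/-- Together with `trace_mul` for the tensor power, this says that the trace of a product of
elementary tensor operators factors over the copies. -/
theorem IsRankOneSum.hasSum_tensorOp {ι : Type*} {u : ι → L2 α} {T : L2 α →L[ℂ] L2 α}
    (h : IsRankOneSum u T) (B : Fin n → L2 α →L[ℂ] L2 α) :
    HasSum (fun I : Fin n → ι => ⟪tensorVec fun k => u (I k),
      QMeas.tensorOp B (tensorVec fun k => u (I k))⟫_ℂ) (∏ k, trace (T * B k)) := by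
  simp only [tensorOp_tensorVec, inner_tensorVec, h.trace_mul]
  exact (hasSum_prod_pi (fun k i => ⟪u i, B k (u i)⟫_ℂ) fun k => h.summable_inner (B k)).2

end TensorOperators

/-! ### Orthogonal mixing of copies -/

section Mixing

variable {n : ℕ} {E : Type*} [AddCommGroup E] [Module ℝ E]

/-- The action of an `n × n` matrix on `n`-tuples of vectors. -/
def mix (O : Matrix (Fin n) (Fin n) ℝ) : (Fin n → E) →ₗ[ℝ] (Fin n → E) where
  toFun z k := ∑ l, O k l • z l
  map_add' z w := by
    funext k
    simp [Finset.sum_add_distrib]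
  map_smul' c z := by
    funext k
    simp [Finset.smul_sum, smul_comm c]

theorem mix_apply (O : Matrix (Fin n) (Fin n) ℝ) (z : Fin n → E) (k : Fin n) :
    mix O z k = ∑ l, O k l • z l := rfl

theorem mix_mix (O P : Matrix (Fin n) (Fin n) ℝ) (z : Fin n → E) :
    mix O (mix P z) = mix (O * P) z := by
  funext k
  simp only [mix_apply, Matrix.mul_apply, Finset.smul_sum, Finset.sum_smul, smul_smul]
  exact Finset.sum_comm

theorem mix_one (z : Fin n → E) : mix (1 : Matrix (Fin n) (Fin n) ℝ) z = z := by
  funext k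
  simp [mix_apply, Matrix.one_apply, ite_smul]

/-- The invertible linear map given by an orthogonal matrix. -/
def mixEquiv (O : Matrix (Fin n) (Fin n) ℝ) (hO : O ∈ Matrix.orthogonalGroup (Fin n) ℝ) :
    (Fin n → E) ≃ₗ[ℝ] (Fin n → E) :=
  LinearEquiv.ofLinearMap (mix O) (mix O.transpose)
    (LinearMap.ext fun z => by
      simp only [LinearMap.comp_apply, LinearMap.id_apply, mix_mix]
      rw [(Matrix.mem_orthogonalGroup_iff (Fin n) ℝ).1 hO, mix_one])
    (LinearMap.ext fun z => by
      simp only [LinearMap.comp_apply, LinearMap.id_apply, mix_mix]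
      rw [(Matrix.mem_orthogonalGroup_iff' (Fin n) ℝ).1 hO, mix_one])

theorem transpose_mem_orthogonalGroup {O : Matrix (Fin n) (Fin n) ℝ}
    (hO : O ∈ Matrix.orthogonalGroup (Fin n) ℝ) :
    O.transpose ∈ Matrix.orthogonalGroup (Fin n) ℝ := by
  rw [Matrix.mem_orthogonalGroup_iff, Matrix.transpose_transpose]
  exact (Matrix.mem_orthogonalGroup_iff' (Fin n) ℝ).1 hO

/-- Orthogonal mixing of copies preserves bilinear forms summed over the copies. -/
theorem sum_mix_mix {O : Matrix (Fin n) (Fin n) ℝ} (hO : O ∈ Matrix.orthogonalGroup (Fin n) ℝ)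
    {F : Type*} [AddCommGroup F] [Module ℝ F] (b : E →ₗ[ℝ] F →ₗ[ℝ] ℝ) (x : Fin n → E)
    (y : Fin n → F) : ∑ k, b (mix O x k) (mix O y k) = ∑ k, b (x k) (y k) := by
  have h : ∀ l m, ∑ k, O k l * O k m = if l = m then 1 else 0 := fun l m => by
    have := congrFun (congrFun ((Matrix.mem_orthogonalGroup_iff' (Fin n) ℝ).1 hO) l) m
    simpa [Matrix.mul_apply, Matrix.one_apply, Matrix.star_apply] using this
  simp only [mix_apply, map_sum, map_smul, LinearMap.sum_apply, LinearMap.smul_apply, smul_eq_mul,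
    Finset.mul_sum]
  calc ∑ k, ∑ l, ∑ m, O k l * (O k m * b (x m) (y l))
      = ∑ l, ∑ m, (∑ k, O k l * O k m) * b (x m) (y l) := by
        rw [Finset.sum_comm]
        refine Finset.sum_congr rfl fun l _ => ?_
        rw [Finset.sum_comm]
        refine Finset.sum_congr rfl fun m _ => ?_
        rw [Finset.sum_mul]
        exact Finset.sum_congr rfl fun k _ => by ring
    _ = ∑ k, b (x k) (y k) := by
        simp [h]

/-- An invertible linear map rescales a Haar measure by a constant. The constant is 1 because a set
of finite positive measure, the Euclidean unit ball, is its own preimage. -/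
theorem measurePreserving_mix {κ : Type*} [Fintype κ] {O : Matrix (Fin n) (Fin n) ℝ}
    (hO : O ∈ Matrix.orthogonalGroup (Fin n) ℝ) (μ : Measure (Fin n → κ → ℝ))
    [μ.IsAddHaarMeasure] : MeasurePreserving (mix O) μ μ := by
  let f : (Fin n → κ → ℝ) ≃ₗ[ℝ] (Fin n → κ → ℝ) := mixEquiv O hO
  have hf : LinearMap.det (f : (Fin n → κ → ℝ) →ₗ[ℝ] (Fin n → κ → ℝ)) ≠ 0 :=
    (LinearEquiv.isUnit_det' f).ne_zero
  have hcont : Continuous (mix O : (Fin n → κ → ℝ) →ₗ[ℝ] _) :=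
    LinearMap.continuous_of_finiteDimensional _
  have hmap := Measure.map_linearMap_addHaar_eq_smul_addHaar μ hf
  change Measure.map (mix O) μ = _ at hmap
  refine ⟨hcont.measurable, ?_⟩
  -- The ball is cut out by the quadratic form: the norm of the product space is the supremum norm,
  -- whose balls are not invariant.
  let B : Set (Fin n → κ → ℝ) := {z | ∑ k, ∑ a, z k a * z k a < 1}
  have hBo : IsOpen B := isOpen_lt (by fun_prop) continuous_const
  have hB0 : μ B ≠ 0 := (hBo.measure_pos μ ⟨0, by simp [B]⟩).ne'
  have hBt : μ B ≠ ∞ := by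
    refine measure_ne_top_of_subset (fun z hz => ?_)
      (isCompact_closedBall (0 : Fin n → κ → ℝ) 1).measure_ne_top (μ := μ)
    rw [mem_closedBall_zero_iff, pi_norm_le_iff_of_nonneg zero_le_one]
    intro k
    rw [pi_norm_le_iff_of_nonneg zero_le_one]
    intro a
    have h1 : z k a * z k a ≤ ∑ a, z k a * z k a :=
      Finset.single_le_sum (f := fun a => z k a * z k a) (fun a _ => mul_self_nonneg _)
        (Finset.mem_univ a)
    have h2 : ∑ a, z k a * z k a ≤ ∑ k, ∑ a, z k a * z k a :=
      Finset.single_le_sum (f := fun k => ∑ a, z k a * z k a)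
        (fun k _ => Finset.sum_nonneg fun a _ => mul_self_nonneg _) (Finset.mem_univ k)
    have h3 : ∑ k, ∑ a, z k a * z k a < 1 := hz
    rw [Real.norm_eq_abs]
    exact abs_le_one_iff_mul_self_le_one.2 (by linarith)
  have hpre : mix O ⁻¹' B = B := by
    ext z
    simp only [B, Set.mem_preimage, Set.mem_ofPred_eq]
    have := sum_mix_mix hO (dotProductBilin ℝ ℝ) z z
    simp only [dotProductBilin_apply_apply, dotProduct] at this
    rw [this]
  have hval := congrArg (fun ν => ν B) hmap
  simp only [Measure.map_apply hcont.measurable hBo.measurableSet, hpre, Measure.smul_apply,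
    smul_eq_mul] at hval
  have hc : ENNReal.ofReal |(LinearMap.det (f : (Fin n → κ → ℝ) →ₗ[ℝ] (Fin n → κ → ℝ)))⁻¹| = 1 :=
    (ENNReal.eq_div_iff hB0 hBt).2 (by rw [mul_comm]; exact hval.symm) |>.trans
      (ENNReal.div_self hB0 hBt)
  rw [hmap, hc, one_smul]

end Mixing

/-! ### Injectivity of the Fourier transform on integrable functions -/

section Fourier

variable {V : Type*} [NormedAddCommGroup V] [NormedSpace ℝ V]

theorem norm_exp_dual (L : StrongDual ℝ V) (v : V) : ‖Complex.exp (L v * Complex.I)‖ = 1 :=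
  Complex.norm_exp_ofReal_mul_I _

variable [MeasurableSpace V] {μ : Measure V}

theorem charFunDual_withDensity {g : V → ℝ} (hg : AEMeasurable g μ) (L : StrongDual ℝ V) :
    charFunDual (μ.withDensity fun v => ENNReal.ofReal (g v)) L =
      ∫ v, ((max (g v) 0 : ℝ) : ℂ) * Complex.exp (L v * Complex.I) ∂μ := by
  rw [charFunDual_apply,
    integral_withDensity_eq_integral_toReal_smul₀ hg.ennreal_ofReal (by simp)]
  refine integral_congr_ae (Filter.Eventually.of_forall fun v => ?_)
  simp [ENNReal.toReal_ofReal']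

variable [BorelSpace V]

theorem integrable_mul_exp_dual {f : V → ℂ} (hf : Integrable f μ) (L : StrongDual ℝ V) :
    Integrable (fun v => f v * Complex.exp (L v * Complex.I)) μ := by
  refine hf.mul_bdd (c := 1) ?_ (Filter.Eventually.of_forall fun v => (norm_exp_dual L v).le)
  exact Continuous.aestronglyMeasurable (by fun_prop)

variable [SecondCountableTopology V] [CompleteSpace V]

/-- A real integrable function whose Fourier transform vanishes is zero. -/
theorem ae_eq_zero_of_fourier_real {g : V → ℝ} (hg : Integrable g μ)
    (h : ∀ L : StrongDual ℝ V, ∫ v, (g v : ℂ) * Complex.exp (L v * Complex.I) ∂μ = 0) :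
    g =ᵐ[μ] 0 := by
  have hfin : ∀ g : V → ℝ, Integrable g μ →
      ∫⁻ v, ENNReal.ofReal (g v) ∂μ ≠ ∞ := fun g hg => hg.lintegral_lt_top.ne
  have i1 := isFiniteMeasure_withDensity (hfin g hg)
  have i2 := isFiniteMeasure_withDensity (hfin _ hg.neg)
  -- The positive and negative parts of `g` are densities of finite measures with the same
  -- characteristic function, so these measures are equal.
  have hmeas : (μ.withDensity fun v => ENNReal.ofReal (g v)) =
      μ.withDensity fun v => ENNReal.ofReal ((-g) v) := by
    refine Measure.ext_of_charFunDual (funext fun L => ?_)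
    rw [charFunDual_withDensity hg.aemeasurable, charFunDual_withDensity hg.neg.aemeasurable,
      ← sub_eq_zero, ← integral_sub, ← h L]
    · refine integral_congr_ae (Filter.Eventually.of_forall fun v => ?_)
      have : g v = max (g v) 0 - max (-g v) 0 := by
        rcases le_total (g v) 0 with h0 | h0
        · rw [max_eq_right h0, max_eq_left (by linarith)]; ring
        · rw [max_eq_left h0, max_eq_right (by linarith)]; ring
      simp only [Pi.neg_apply]
      rw [← sub_mul, ← Complex.ofReal_sub, ← this]
    · exact integrable_mul_exp_dual hg.pos_part.ofReal L
    · exact integrable_mul_exp_dual hg.neg.pos_part.ofReal L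
  have := (withDensity_eq_iff hg.aemeasurable.ennreal_ofReal hg.neg.aemeasurable.ennreal_ofReal
    (hfin g hg)).1 hmeas
  filter_upwards [this] with v hv
  -- At each point one of the two parts is zero; as they agree, so is the other.
  rcases le_total (g v) 0 with h0 | h0
  · rw [ENNReal.ofReal_of_nonpos h0, eq_comm, ENNReal.ofReal_eq_zero, Pi.neg_apply] at hv
    simp only [Pi.zero_apply]
    linarith
  · rw [ENNReal.ofReal_of_nonpos (p := (-g) v) (by simpa using h0), ENNReal.ofReal_eq_zero] at hv
    exact le_antisymm hv h0

/-- A complex integrable function whose Fourier transform vanishes is zero. -/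
theorem ae_eq_zero_of_fourier {f : V → ℂ} (hf : Integrable f μ)
    (h : ∀ L : StrongDual ℝ V, ∫ v, f v * Complex.exp (L v * Complex.I) ∂μ = 0) :
    f =ᵐ[μ] 0 := by
  -- The transform of the conjugate at `L` is the conjugate of the transform at `-L`. Hence the real
  -- and imaginary parts of `f` also have vanishing transforms.
  have hconj : ∀ L : StrongDual ℝ V,
      ∫ v, (starRingEnd ℂ) (f v) * Complex.exp (L v * Complex.I) ∂μ = 0 := fun L => by
    have h1 := congrArg (starRingEnd ℂ) (h (-L))
    rw [map_zero, ← integral_conj] at h1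
    rw [← h1]
    refine integral_congr_ae (Filter.Eventually.of_forall fun v => ?_)
    simp [← Complex.exp_conj]
  have hfc : Integrable (fun v => (starRingEnd ℂ) (f v)) μ := by
    simpa using (Complex.conjCLE.toContinuousLinearMap.integrable_comp hf)
  have hre : (fun v => (f v).re) =ᵐ[μ] 0 := by
    refine ae_eq_zero_of_fourier_real hf.re fun L => ?_
    have h2 := integral_add (integrable_mul_exp_dual hf L) (integrable_mul_exp_dual hfc L)
    rw [h, hconj, add_zero] at h2
    have h3 : ∫ v, 2 * (((f v).re : ℂ) * Complex.exp (L v * Complex.I)) ∂μ = 0 := by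
      rw [← h2]
      refine integral_congr_ae (Filter.Eventually.of_forall fun v => ?_)
      simp only
      rw [← add_mul, Complex.add_conj]
      push_cast
      ring
    rw [integral_const_mul] at h3
    simpa using h3
  have him : (fun v => (f v).im) =ᵐ[μ] 0 := by
    refine ae_eq_zero_of_fourier_real hf.im fun L => ?_
    have h2 := integral_sub (integrable_mul_exp_dual hf L) (integrable_mul_exp_dual hfc L)
    rw [h, hconj, sub_zero] at h2
    have h3 : ∫ v, (2 * Complex.I) * (((f v).im : ℂ) * Complex.exp (L v * Complex.I)) ∂μ = 0 := by
      rw [← h2]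
      refine integral_congr_ae (Filter.Eventually.of_forall fun v => ?_)
      simp only
      rw [← sub_mul, Complex.sub_conj]
      push_cast
      ring
    rw [integral_const_mul] at h3
    simpa using h3
  filter_upwards [hre, him] with v h1 h2
  exact Complex.ext h1 h2

end Fourier

/-! ### Isometries of `L²` given by substitution and unimodular factors -/

section WeightedComposition

variable {α : Type*} [MeasureSpace α]

theorem memLp_weightedComp {c : α → ℂ} (hc : Measurable c) (hc1 : ∀ ξ, ‖c ξ‖ = 1) {T : α → α}
    (hT : MeasurePreserving T volume volume) (ψ : L2 α) :
    MemLp (fun ξ => c ξ * ψ (T ξ)) 2 volume := by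
  have h := (Lp.memLp ψ).comp_measurePreserving hT
  refine h.of_le (hc.aestronglyMeasurable.mul h.1) ?_
  filter_upwards with ξ
  rw [norm_mul, hc1, one_mul]
  rfl

theorem weightedComp_congr (c : α → ℂ) {T : α → α} (hT : MeasurePreserving T volume volume)
    {f g : α → ℂ} (h : f =ᵐ[volume] g) :
    (fun ξ => c ξ * f (T ξ)) =ᵐ[volume] fun ξ => c ξ * g (T ξ) := by
  filter_upwards [hT.quasiMeasurePreserving.ae h] with ξ hξ
  rw [hξ]

/-- The isometry `ψ ↦ c · (ψ ∘ T)` of `L²`, for a unimodular function `c` and a measure preserving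
map `T`. -/
def weightedComp {c : α → ℂ} (hc : Measurable c) (hc1 : ∀ ξ, ‖c ξ‖ = 1) {T : α → α}
    (hT : MeasurePreserving T volume volume) : L2 α →ₗᵢ[ℂ] L2 α where
  toFun ψ := (memLp_weightedComp hc hc1 hT ψ).toLp _
  map_add' ψ φ := by
    rw [← MemLp.toLp_add]
    refine MemLp.toLp_congr _ _ ?_
    filter_upwards [weightedComp_congr c hT (Lp.coeFn_add ψ φ)] with ξ h
    rw [h]
    simp only [Pi.add_apply, mul_add]
  map_smul' a ψ := by
    rw [RingHom.id_apply, ← MemLp.toLp_const_smul]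
    refine MemLp.toLp_congr _ _ ?_
    filter_upwards [weightedComp_congr c hT (Lp.coeFn_smul a ψ)] with ξ h
    rw [h]
    simp only [Pi.smul_apply, smul_eq_mul]
    ring
  norm_map' ψ := by
    have h := eLpNorm_comp_measurePreserving (p := 2) (Lp.aestronglyMeasurable ψ) hT
    change ‖(memLp_weightedComp hc hc1 hT ψ).toLp _‖ = ‖ψ‖
    rw [Lp.norm_toLp, Lp.norm_def, ← h]
    refine congrArg ENNReal.toReal (eLpNorm_congr_norm_ae ?_)
    filter_upwards with ξ
    rw [norm_mul, hc1, one_mul]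
    rfl

theorem coeFn_weightedComp {c : α → ℂ} (hc : Measurable c) (hc1 : ∀ ξ, ‖c ξ‖ = 1) {T : α → α}
    (hT : MeasurePreserving T volume volume) (ψ : L2 α) :
    weightedComp hc hc1 hT ψ =ᵐ[volume] fun ξ => c ξ * ψ (T ξ) :=
  (memLp_weightedComp hc hc1 hT ψ).coeFn_toLp

/-- The unitary operator `ψ ↦ ψ ∘ T` of `L²`, for an invertible measure preserving map `T`. -/
def compUnitary (T S : α → α) (hT : MeasurePreserving T volume volume)
    (hS : MeasurePreserving S volume volume) (hTS : ∀ ξ, T (S ξ) = ξ) (hST : ∀ ξ, S (T ξ) = ξ) :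
    unitary (L2 α →L[ℂ] L2 α) :=
  Unitary.linearIsometryEquiv.symm <|
    { Lp.compMeasurePreservingₗᵢ (p := 2) (E := ℂ) ℂ T hT with
      invFun := Lp.compMeasurePreservingₗᵢ (p := 2) (E := ℂ) ℂ S hS
      left_inv := fun ψ => Lp.ext <| by
        refine (Lp.coeFn_compMeasurePreserving _ hS).trans ?_
        refine (hS.quasiMeasurePreserving.ae_eq_comp (Lp.coeFn_compMeasurePreserving ψ hT)).trans ?_
        exact Filter.Eventually.of_forall fun ξ => congrArg ψ (hTS ξ)
      right_inv := fun ψ => Lp.ext <| by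
        refine (Lp.coeFn_compMeasurePreserving _ hT).trans ?_
        refine (hT.quasiMeasurePreserving.ae_eq_comp (Lp.coeFn_compMeasurePreserving ψ hS)).trans ?_
        exact Filter.Eventually.of_forall fun ξ => congrArg ψ (hST ξ) }

theorem coeFn_compUnitary (T S : α → α) (hT : MeasurePreserving T volume volume)
    (hS : MeasurePreserving S volume volume) (hTS : ∀ ξ, T (S ξ) = ξ) (hST : ∀ ξ, S (T ξ) = ξ)
    (ψ : L2 α) :
    (compUnitary T S hT hS hTS hST : L2 α →L[ℂ] L2 α) ψ =ᵐ[volume] fun ξ => ψ (T ξ) :=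
  Lp.coeFn_compMeasurePreserving ψ hT

end WeightedComposition

/-! ### Displacement operators of `n` copies and the unitary implementing `O` -/

section CopyDisplacement

instance isAddHaarMeasure_volume_pi_pi {ι κ : Type*} [Fintype ι] [Fintype κ] :
    (volume : Measure (ι → κ → ℝ)).IsAddHaarMeasure :=
  Measure.pi.isAddHaarMeasure fun _ => (volume : Measure (κ → ℝ))

variable {s n : ℕ}

/-- The position part `x` of `z = [x, y]`, for `n` copies. -/
def positionPart (z : Fin n → Phase s) : Fin n → Fin s → ℝ := fun k j => z k (j, 0)

/-- The momentum part `y` of `z = [x, y]`, for `n` copies. -/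
def momentumPart (z : Fin n → Phase s) : Fin n → Fin s → ℝ := fun k j => z k (j, 1)

/-- The unimodular factor of the displacement operator of `n` copies. -/
def copyPhase (z : Fin n → Phase s) (ξ : Fin n → Fin s → ℝ) : ℂ :=
  Complex.exp (((∑ k, momentumPart z k ⬝ᵥ (ξ k - (2⁻¹ : ℝ) • positionPart z k) : ℝ) : ℂ) *
    Complex.I)

theorem prod_phaseFactor (z : Fin n → Phase s) (ξ : Fin n → Fin s → ℝ) :
    ∏ k, phaseFactor (z k) (ξ k) = copyPhase z ξ := by
  simp only [phaseFactor, copyPhase, ← Complex.exp_sum, ← Finset.sum_mul, ← Complex.ofReal_sum]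
  simp [dotProduct, momentumPart, positionPart, div_eq_inv_mul]

theorem norm_copyPhase (z : Fin n → Phase s) (ξ : Fin n → Fin s → ℝ) : ‖copyPhase z ξ‖ = 1 :=
  Complex.norm_exp_ofReal_mul_I _

theorem measurable_copyPhase (z : Fin n → Phase s) : Measurable (copyPhase z) := by
  refine Continuous.measurable ?_
  unfold copyPhase
  simp only [dotProduct, Pi.sub_apply, Pi.smul_apply]
  fun_prop

theorem measurePreserving_sub_const (x : Fin n → Fin s → ℝ) :
    MeasurePreserving (fun ξ => ξ - x) (volume : Measure (Fin n → Fin s → ℝ)) volume :=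
  measurePreserving_sub_right volume x

/-- The tensor product is explicit only on elementary tensors. The formula on the right defines an
isometry of `L²` that agrees with it there, so density gives it for every `ψ`. -/
theorem coeFn_copyDisplacement (z : Fin n → Phase s) (ψ : CopySpace s n) :
    copyDisplacement z ψ =ᵐ[volume] fun ξ => copyPhase z ξ * ψ (ξ - positionPart z) := by
  have h : copyDisplacement z = (weightedComp (measurable_copyPhase z) (norm_copyPhase z)
      (measurePreserving_sub_const (positionPart z))).toContinuousLinearMap := by
    refine clm_ext_tensorVec fun f => Lp.ext ?_
    rw [copyDisplacement, tensorOp_tensorVec]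
    have h1 : ∀ᵐ ξ : Fin n → Fin s → ℝ, ∀ k, displacement (z k) (f k) (ξ k) =
        phaseFactor (z k) (ξ k) * f k (ξ k - fun j => z k (j, 0)) :=
      ae_all_iff.2 fun k => (Measure.quasiMeasurePreserving_eval
        (fun _ : Fin n => (volume : Measure (Fin s → ℝ))) k).ae (coeFn_displacement (z k) (f k))
    filter_upwards [h1, coeFn_tensorVec fun k => displacement (z k) (f k),
      coeFn_weightedComp (measurable_copyPhase z) (norm_copyPhase z)
        (measurePreserving_sub_const (positionPart z)) (tensorVec f),
      weightedComp_congr (copyPhase z) (measurePreserving_sub_const (positionPart z))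
        (coeFn_tensorVec f)] with ξ h2 h3 h4 h5
    rw [h3]
    refine Eq.trans ?_ (h4.trans h5).symm
    simp only [h2, Finset.prod_mul_distrib, prod_phaseFactor]
    rfl
  rw [h]
  exact coeFn_weightedComp (measurable_copyPhase z) (norm_copyPhase z)
    (measurePreserving_sub_const (positionPart z)) ψ

theorem sum_dotProduct_mix {κ : Type*} [Fintype κ] {O : Matrix (Fin n) (Fin n) ℝ}
    (hO : O ∈ Matrix.orthogonalGroup (Fin n) ℝ) (x y : Fin n → κ → ℝ) :
    ∑ k, mix O x k ⬝ᵥ mix O y k = ∑ k, x k ⬝ᵥ y k :=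
  sum_mix_mix hO (dotProductBilin ℝ ℝ) x y

theorem positionPart_mixCopies (O : Matrix (Fin n) (Fin n) ℝ) (z : Fin n → Phase s) :
    positionPart (mixCopies O z) = mix O (positionPart z) := by
  funext k j
  simp [positionPart, mixCopies, mix_apply]

theorem momentumPart_mixCopies (O : Matrix (Fin n) (Fin n) ℝ) (z : Fin n → Phase s) :
    momentumPart (mixCopies O z) = mix O (momentumPart z) := by
  funext k j
  simp [momentumPart, mixCopies, mix_apply]

theorem copyPhase_mixCopies {O : Matrix (Fin n) (Fin n) ℝ}
    (hO : O ∈ Matrix.orthogonalGroup (Fin n) ℝ) (z : Fin n → Phase s) (ξ : Fin n → Fin s → ℝ) :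
    copyPhase (mixCopies O z) (mix O ξ) = copyPhase z ξ := by
  simp only [copyPhase, positionPart_mixCopies, momentumPart_mixCopies]
  have h := sum_dotProduct_mix hO (momentumPart z) (ξ - (2⁻¹ : ℝ) • positionPart z)
  rw [map_sub, map_smul] at h
  simp only [Pi.sub_apply, Pi.smul_apply] at h
  rw [h]

/-- The witness is `(Uψ)(ξ) = ψ(Oξ)`. Both `D(z)U` and `U D(Oz)` send `ψ` to a phase times `ψ(Oξ -
Ox)`, and the phases agree by `copyPhase_mixCopies`. -/
theorem exists_implements {O : Matrix (Fin n) (Fin n) ℝ}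
    (hO : O ∈ Matrix.orthogonalGroup (Fin n) ℝ) :
    ∃ U : unitary (CopySpace s n →L[ℂ] CopySpace s n), Implements U O := by
  have hOt := transpose_mem_orthogonalGroup hO
  have hT := measurePreserving_mix hO (volume : Measure (Fin n → Fin s → ℝ))
  have hS := measurePreserving_mix hOt (volume : Measure (Fin n → Fin s → ℝ))
  let U := compUnitary (mix O) (mix O.transpose) hT hS (mixEquiv O hO).right_inv
    (mixEquiv O hO).left_inv
  have hU : ∀ ψ : CopySpace s n, (U : CopySpace s n →L[ℂ] CopySpace s n) ψ =ᵐ[volume]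
      fun ξ => ψ (mix O ξ) := coeFn_compUnitary _ _ _ _ _ _
  refine ⟨U, fun z => ?_⟩
  have key : copyDisplacement z * (U : CopySpace s n →L[ℂ] CopySpace s n) =
      U * copyDisplacement (mixCopies O z) := by
    refine ContinuousLinearMap.ext fun ψ => Lp.ext ?_
    simp only [mul_apply_eq_comp]
    filter_upwards [coeFn_copyDisplacement z ((U : CopySpace s n →L[ℂ] CopySpace s n) ψ),
      hU (copyDisplacement (mixCopies O z) ψ),
      (measurePreserving_sub_const (positionPart z)).quasiMeasurePreserving.ae (hU ψ),
      hT.quasiMeasurePreserving.ae (coeFn_copyDisplacement (mixCopies O z) ψ)]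
      with ξ h1 h2 h3 h4
    rw [h1, h2, h3, h4, copyPhase_mixCopies hO, positionPart_mixCopies, map_sub]
  rw [mul_assoc, key, ← mul_assoc, Unitary.coe_star_mul_self, one_mul]

end CopyDisplacement

/-! ### Exchanging series and integrals -/

section SeriesOfIntegrals

theorem integral_norm_mul_norm_le {α : Type*} [MeasurableSpace α] {μ : Measure α}
    (a b : Lp ℂ 2 μ) : ∫ ξ, ‖a ξ‖ * ‖b ξ‖ ∂μ ≤ ‖a‖ * ‖b‖ := by
  have h2 : ENNReal.ofReal 2 = 2 := by simp
  have h := integral_mul_norm_le_Lp_mul_Lq (μ := μ) (f := a) (g := b) Real.HolderConjugate.two_two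
    (by rw [h2]; exact Lp.memLp a) (by rw [h2]; exact Lp.memLp b)
  have hn : ∀ a : Lp ℂ 2 μ, (∫ ξ, ‖a ξ‖ ^ (2 : ℝ) ∂μ) ^ (1 / 2 : ℝ) = ‖a‖ := fun a => by
    have h1 : ⟪a, a⟫_ℂ = ((‖a‖ ^ 2 : ℝ) : ℂ) := by
      rw [inner_self_eq_norm_sq_to_K]
      norm_cast
    have h3 : ∀ ξ, ⟪a ξ, a ξ⟫_ℂ = ((‖a ξ‖ ^ 2 : ℝ) : ℂ) := fun ξ => by
      rw [inner_self_eq_norm_sq_to_K]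
      norm_cast
    rw [L2.inner_def] at h1
    simp only [h3, integral_complex_ofReal, Complex.ofReal_inj] at h1
    simp only [Real.rpow_two]
    rw [← Real.sqrt_eq_rpow, h1, Real.sqrt_sq (norm_nonneg _)]
  rwa [hn, hn] at h

theorem integrable_tsum {α ι : Type*} [Countable ι] [MeasurableSpace α] {μ : Measure α}
    {F : ι → α → ℂ} (hF : ∀ i, Integrable (F i) μ) (hs : Summable fun i => ∫ ξ, ‖F i ξ‖ ∂μ) :
    Integrable (fun ξ => ∑' i, F i ξ) μ := by
  refine ⟨(AEMeasurable.tsum fun i => (hF i).aemeasurable).aestronglyMeasurable, ?_⟩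
  calc ∫⁻ ξ, ‖∑' i, F i ξ‖ₑ ∂μ ≤ ∫⁻ ξ, ∑' i, ‖F i ξ‖ₑ ∂μ :=
        lintegral_mono fun ξ => enorm_tsum_le_tsum_enorm
    _ = ∑' i, ∫⁻ ξ, ‖F i ξ‖ₑ ∂μ := lintegral_tsum fun i => (hF i).1.enorm
    _ = ∑' i, ENNReal.ofReal (∫ ξ, ‖F i ξ‖ ∂μ) := by
        simp only [ofReal_integral_norm_eq_lintegral_enorm (hF _)]
    _ < ∞ := by
        rw [← ENNReal.ofReal_tsum_of_nonneg (fun i => integral_nonneg fun _ => norm_nonneg _) hs]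
        exact ENNReal.ofReal_lt_top

/-- If `∑ᵢ Aᵢ(ξ) Bᵢ(ξ - x)` vanishes for every `x` and almost every `ξ`, then
`∑ᵢ (∫ Aᵢ) (∫ Bᵢ)` vanishes. -/
theorem tsum_integral_mul_integral_eq_zero {V ι : Type*} [Countable ι] [AddCommGroup V]
    [MeasurableSpace V] [MeasurableAdd₂ V] [MeasurableNeg V] {μ : Measure V} [SFinite μ]
    [μ.IsAddLeftInvariant] [μ.IsNegInvariant] {A B : ι → V → ℂ} (hA : ∀ i, Integrable (A i) μ)
    (hB : ∀ i, Integrable (B i) μ)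
    (hs : Summable fun i => (∫ ξ, ‖A i ξ‖ ∂μ) * ∫ ξ, ‖B i ξ‖ ∂μ)
    (h : ∀ x, ∀ᵐ ξ ∂μ, ∑' i, A i ξ * B i (ξ - x) = 0) :
    ∑' i, (∫ ξ, A i ξ ∂μ) * ∫ ξ, B i ξ ∂μ = 0 := by
  -- The shear `(ξ, x) ↦ (ξ, ξ - x)` is a reflection in `x` followed by `(ξ, x) ↦ (ξ, ξ + x)`. It
  -- turns the integral of `Aᵢ(ξ) Bᵢ(ξ - x)` into a product of two integrals.
  have hT : MeasurePreserving (fun p : V × V => (p.1, p.1 - p.2)) (μ.prod μ) (μ.prod μ) := by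
    have := (measurePreserving_prod_add μ μ).comp
      ((MeasurePreserving.id μ).prod (Measure.measurePreserving_neg μ))
    simpa only [Function.comp_def, Prod.map, id, ← sub_eq_add_neg] using this
  have hG : ∀ i, Integrable (fun p : V × V => A i p.1 * B i p.2) (μ.prod μ) :=
    fun i => (hA i).mul_prod (hB i)
  have hGT : ∀ i, Integrable (fun p : V × V => A i p.1 * B i (p.1 - p.2)) (μ.prod μ) :=
    fun i => hT.integrable_comp_of_integrable (hG i)
  have hcomp : ∀ F : V × V → ℂ, Integrable F (μ.prod μ) →
      ∫ p, F (p.1, p.1 - p.2) ∂(μ.prod μ) = ∫ p, F p ∂(μ.prod μ) := fun F hF => by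
    have := integral_map hT.aemeasurable (f := F) (by rw [hT.map_eq]; exact hF.1)
    rw [hT.map_eq] at this
    exact this.symm
  have hnorm : ∀ i, ∫ p : V × V, ‖A i p.1 * B i (p.1 - p.2)‖ ∂(μ.prod μ) =
      (∫ ξ, ‖A i ξ‖ ∂μ) * ∫ ξ, ‖B i ξ‖ ∂μ := fun i => by
    have := integral_map hT.aemeasurable (f := fun p : V × V => ‖A i p.1 * B i p.2‖)
      (by rw [hT.map_eq]; exact (hG i).norm.1)
    rw [hT.map_eq] at this
    rw [← this, ← integral_prod_mul]
    simp only [norm_mul]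
  have hs' : Summable fun i => ∫ p : V × V, ‖A i p.1 * B i (p.1 - p.2)‖ ∂(μ.prod μ) := by
    simpa only [hnorm] using hs
  calc ∑' i, (∫ ξ, A i ξ ∂μ) * ∫ ξ, B i ξ ∂μ
      = ∑' i, ∫ p : V × V, A i p.1 * B i (p.1 - p.2) ∂(μ.prod μ) := by
        refine tsum_congr fun i => ?_
        rw [← integral_prod_mul]
        exact (hcomp _ (hG i)).symm
    _ = ∫ p : V × V, ∑' i, A i p.1 * B i (p.1 - p.2) ∂(μ.prod μ) :=
        integral_tsum_of_summable_integral_norm hGT hs'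
    -- The shift `x` becomes the outer variable, since the hypothesis is an almost-everywhere
    -- statement in `ξ` for each fixed `x`.
    _ = ∫ x, ∫ ξ, ∑' i, A i ξ * B i (ξ - x) ∂μ ∂μ :=
        integral_prod_symm _ (integrable_tsum hGT hs')
    _ = 0 := by
        simp only [integral_congr_ae (h _), integral_zero]

end SeriesOfIntegrals

/-! ### Displacement operators separate trace-class operators -/

section WeylInjectivity

variable {s n : ℕ}

/-- The point `[x, y]` of the phase space of `n` copies. -/
def phasePoint (x y : Fin n → Fin s → ℝ) : Fin n → Phase s :=
  fun k p => if p.2 = 0 then x k p.1 else y k p.1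

theorem positionPart_phasePoint (x y : Fin n → Fin s → ℝ) : positionPart (phasePoint x y) = x :=
  rfl

theorem momentumPart_phasePoint (x y : Fin n → Fin s → ℝ) : momentumPart (phasePoint x y) = y :=
  rfl

theorem exists_dual_eq_dotProduct (L : StrongDual ℝ (Fin n → Fin s → ℝ)) :
    ∃ y : Fin n → Fin s → ℝ, ∀ ξ, L ξ = ∑ k, y k ⬝ᵥ ξ k := by
  refine ⟨fun k j => L (Pi.single k (Pi.single j 1)), fun ξ => ?_⟩
  rw [← L.sum_comp_single]
  refine Finset.sum_congr rfl fun k _ => ?_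
  have h := ContinuousLinearMap.sum_comp_single (R := ℝ)
    (L := L.comp (ContinuousLinearMap.single ℝ (fun _ : Fin n => Fin s → ℝ) k)) (v := ξ k)
  rw [← h, dotProduct]
  refine Finset.sum_congr rfl fun j _ => ?_
  have e : (Pi.single j (ξ k j) : Fin s → ℝ) = ξ k j • Pi.single j 1 := by
    rw [← Pi.single_smul', smul_eq_mul, mul_one]
  simp only [ContinuousLinearMap.comp_apply, ContinuousLinearMap.single_apply]
  rw [e, Pi.single_smul', map_smul, smul_eq_mul, mul_comm]

/-- Isolates the character in `ξ`; the remaining factor does not depend on `ξ` and is nonzero, so it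
drops out of vanishing conditions. -/
theorem copyPhase_phasePoint (x y ξ : Fin n → Fin s → ℝ) :
    copyPhase (phasePoint x y) ξ =
      Complex.exp (((-(2⁻¹ * ∑ k, y k ⬝ᵥ x k) : ℝ) : ℂ) * Complex.I) *
        Complex.exp (((∑ k, y k ⬝ᵥ ξ k : ℝ) : ℂ) * Complex.I) := by
  rw [copyPhase, positionPart_phasePoint, momentumPart_phasePoint, ← Complex.exp_add, ← add_mul,
    ← Complex.ofReal_add]
  congr 3
  simp only [dotProduct_sub, dotProduct_smul, Finset.sum_sub_distrib, Finset.mul_sum, smul_eq_mul]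
  ring

/-- The displacement operators separate the trace class operators. -/
theorem tsum_inner_mul_inner_eq_zero {ι : Type*} [Countable ι] {a b : ι → CopySpace s n}
    (ha : Summable fun i => ‖a i‖ ^ 2) (hb : Summable fun i => ‖b i‖ ^ 2)
    (h : ∀ z, ∑' i, ⟪a i, copyDisplacement z (b i)⟫_ℂ = 0) (f g : CopySpace s n) :
    ∑' i, ⟪a i, f⟫_ℂ * ⟪g, b i⟫_ℂ = 0 := by
  have hab : Summable fun i => ‖a i‖ * ‖b i‖ :=
    summable_mul_of_sq ha hb (fun _ => norm_nonneg _) fun _ => norm_nonneg _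
  -- For fixed `x`, the Fourier transform of this function of `ξ` at frequency `y` is, up to a
  -- nonzero factor, the sum of the `⟨aᵢ, D(x, y) bᵢ⟩`, which vanishes by hypothesis.
  have hshift : ∀ x, ∀ᵐ ξ : Fin n → Fin s → ℝ,
      ∑' i, (starRingEnd ℂ) (a i ξ) * b i (ξ - x) = 0 := by
    intro x
    let c : ι → CopySpace s n := fun i =>
      Lp.compMeasurePreserving _ (measurePreserving_sub_const x) (b i)
    have hc : ∀ i, c i =ᵐ[volume] fun ξ => b i (ξ - x) := fun i =>
      Lp.coeFn_compMeasurePreserving (b i) (measurePreserving_sub_const x)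
    have hcn : ∀ i, ‖c i‖ = ‖b i‖ := fun i => Lp.norm_compMeasurePreserving _ _
    have hF : ∀ i, Integrable (fun ξ => (starRingEnd ℂ) (a i ξ) * b i (ξ - x)) volume := by
      intro i
      refine (L2.integrable_inner (𝕜 := ℂ) (a i) (c i)).congr ?_
      filter_upwards [hc i] with ξ hξ
      rw [hξ, RCLike.inner_apply, mul_comm]
    have hFn : Summable fun i => ∫ ξ, ‖(starRingEnd ℂ) (a i ξ) * b i (ξ - x)‖ := by
      refine Summable.of_nonneg_of_le (fun i => integral_nonneg fun _ => norm_nonneg _)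
        (fun i => ?_) hab
      rw [← hcn i]
      refine le_trans (le_of_eq (integral_congr_ae ?_)) (integral_norm_mul_norm_le (a i) (c i))
      filter_upwards [hc i] with ξ hξ
      rw [hξ, norm_mul, RCLike.norm_conj]
    refine ae_eq_zero_of_fourier (integrable_tsum hF hFn) fun L => ?_
    obtain ⟨y, hy⟩ := exists_dual_eq_dotProduct L
    let F : ι → (Fin n → Fin s → ℝ) → ℂ := fun i ξ =>
      (starRingEnd ℂ) (a i ξ) * b i (ξ - x) * Complex.exp (L ξ * Complex.I)
    have hFL : ∀ i, Integrable (F i) volume := fun i => integrable_mul_exp_dual (hF i) L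
    have hFLn : Summable fun i => ∫ ξ, ‖F i ξ‖ := by
      simpa only [F, norm_mul _ (Complex.exp _), norm_exp_dual, mul_one] using hFn
    have e : ∀ i, ⟪a i, copyDisplacement (phasePoint x y) (b i)⟫_ℂ =
        Complex.exp (((-(2⁻¹ * ∑ k, y k ⬝ᵥ x k) : ℝ) : ℂ) * Complex.I) * ∫ ξ, F i ξ := fun i => by
      rw [L2.inner_def, ← integral_const_mul]
      refine integral_congr_ae ?_
      filter_upwards [coeFn_copyDisplacement (phasePoint x y) (b i)] with ξ hξ
      rw [hξ, copyPhase_phasePoint, RCLike.inner_apply, positionPart_phasePoint, ← hy ξ]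
      simp only [F]
      ring
    have h0 := h (phasePoint x y)
    simp only [e, tsum_mul_left] at h0
    have h1 := (mul_eq_zero.1 h0).resolve_left (Complex.exp_ne_zero _)
    rw [integral_tsum_of_summable_integral_norm hFL hFLn] at h1
    simpa only [F, tsum_mul_right] using h1
  have hL : ∀ i, ⟪a i, f⟫_ℂ * ⟪g, b i⟫_ℂ =
      (∫ ξ, ⟪a i ξ, f ξ⟫_ℂ) * ∫ ξ, ⟪g ξ, b i ξ⟫_ℂ := fun i => rfl
  simp only [hL]
  have hle : ∀ u v : CopySpace s n, ∫ ξ, ‖⟪u ξ, v ξ⟫_ℂ‖ ≤ ‖u‖ * ‖v‖ := fun u v => by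
    refine le_trans (le_of_eq ?_) (integral_norm_mul_norm_le u v)
    simp only [RCLike.inner_apply, norm_mul, RCLike.norm_conj, mul_comm]
  -- Applied to the integrands of `⟨aᵢ, f⟩` and `⟨g, bᵢ⟩`. Their products at `ξ` and `ξ - x` are the
  -- terms of `hshift` times a factor independent of `i`.
  refine tsum_integral_mul_integral_eq_zero (fun i => L2.integrable_inner _ _)
    (fun i => L2.integrable_inner _ _) ?_ fun x => ?_
  · refine Summable.of_nonneg_of_le (fun i => mul_nonneg (integral_nonneg fun _ => norm_nonneg _)
      (integral_nonneg fun _ => norm_nonneg _)) (fun i => ?_) (hab.mul_left (‖f‖ * ‖g‖))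
    calc _ ≤ (‖a i‖ * ‖f‖) * (‖g‖ * ‖b i‖) := by
          exact mul_le_mul (hle _ _) (hle _ _) (integral_nonneg fun _ => norm_nonneg _)
            (by positivity)
      _ = _ := by ring
  · filter_upwards [hshift x] with ξ hξ
    have : ∀ i, ⟪a i ξ, f ξ⟫_ℂ * ⟪g (ξ - x), b i (ξ - x)⟫_ℂ =
        (starRingEnd ℂ) (a i ξ) * b i (ξ - x) * (f ξ * (starRingEnd ℂ) (g (ξ - x))) := fun i => by
      simp only [RCLike.inner_apply]
      ring
    simp only [this, tsum_mul_right, hξ, zero_mul]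

end WeylInjectivity

/-! ### Unitary conjugation of trace-class operators -/

section Conjugation

variable {K : Type*} [NormedAddCommGroup K] [InnerProductSpace ℂ K] [CompleteSpace K]

theorem trNorm_conj_le (U : unitary (K →L[ℂ] K)) (T : K →L[ℂ] K) :
    trNorm ((U : K →L[ℂ] K) * T * star (U : K →L[ℂ] K)) ≤ trNorm T := by
  refine trNorm_le fun N e f he hf => ?_
  have ho : ∀ {e : Fin N → K}, Orthonormal ℂ e →
      Orthonormal ℂ fun i => star (U : K →L[ℂ] K) (e i) := fun he =>
    he.comp_linearIsometry (Unitary.linearIsometryEquiv (star U)).toLinearIsometry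
  refine le_trans (le_of_eq ?_) (le_trNorm T (ho he) (ho hf))
  refine Finset.sum_congr rfl fun i _ => ?_
  rw [ContinuousLinearMap.star_eq_adjoint, ContinuousLinearMap.adjoint_inner_left]
  rfl

theorem conj_star_conj (U : unitary (K →L[ℂ] K)) (T : K →L[ℂ] K) :
    star (U : K →L[ℂ] K) * ((U : K →L[ℂ] K) * T * star (U : K →L[ℂ] K)) * U = T := by
  have h := Unitary.coe_star_mul_self U
  calc _ = (star (U : K →L[ℂ] K) * U) * T * (star (U : K →L[ℂ] K) * U) := by
        simp only [mul_assoc]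
    _ = T := by rw [h, one_mul, mul_one]

theorem IsRankOneSum.trace_conj_mul {ι : Type*} {u : ι → K} {T : K →L[ℂ] K}
    (hu : IsRankOneSum u T) (V B : K →L[ℂ] K) :
    trace (V * T * star V * B) = trace (T * (star V * B * V)) := by
  rw [(hu.conj V).trace_mul, hu.trace_mul]
  refine tsum_congr fun i => ?_
  rw [ContinuousLinearMap.star_eq_adjoint, mul_apply_eq_comp, mul_apply_eq_comp,
    ContinuousLinearMap.adjoint_inner_right]

/-- Conjugation `T ↦ U T U*` of trace class operators. -/
def conjTraceClass (U : unitary (K →L[ℂ] K)) : TraceClass K →ₗ[ℂ] TraceClass K where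
  toFun T := ⟨(U : K →L[ℂ] K) * T.toOp * star (U : K →L[ℂ] K),
    ((trNorm_conj_le U T.toOp).trans_lt T.trNorm_ne_top.lt_top).ne⟩
  map_add' S T := TraceClass.toOp_injective <| by
    change (U : K →L[ℂ] K) * (S.toOp + T.toOp) * star (U : K →L[ℂ] K) = _ + _
    rw [mul_add, add_mul]
  map_smul' c T := TraceClass.toOp_injective <| by
    change (U : K →L[ℂ] K) * (c • T.toOp) * star (U : K →L[ℂ] K) = c • _
    rw [mul_smul_comm, smul_mul_assoc]

theorem toOp_conjTraceClass (U : unitary (K →L[ℂ] K)) (T : TraceClass K) :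
    (conjTraceClass U T).toOp = (U : K →L[ℂ] K) * T.toOp * star (U : K →L[ℂ] K) := rfl

theorem conjTraceClass_star (U : unitary (K →L[ℂ] K)) (T : TraceClass K) :
    conjTraceClass (star U) (conjTraceClass U T) = T :=
  TraceClass.toOp_injective <| by
    rw [toOp_conjTraceClass, toOp_conjTraceClass, Unitary.coe_star, star_star]
    exact conj_star_conj U T.toOp

theorem norm_conjTraceClass_le (U : unitary (K →L[ℂ] K)) (T : TraceClass K) :
    ‖conjTraceClass U T‖ ≤ ‖T‖ :=
  ENNReal.toReal_mono T.trNorm_ne_top (trNorm_conj_le U T.toOp)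

/-- Conjugation `T ↦ U T U*` as an isometry of the space of trace class operators. -/
def conjTraceClassIsometry (U : unitary (K →L[ℂ] K)) : TraceClass K →ₗᵢ[ℂ] TraceClass K where
  toLinearMap := conjTraceClass U
  norm_map' T := le_antisymm (norm_conjTraceClass_le U T) <| by
    simpa only [conjTraceClass_star] using norm_conjTraceClass_le (star U) (conjTraceClass U T)

end Conjugation

/-! ### Invariance of the Gaussian product state -/

section GaussianInvariance

variable {s n : ℕ}

theorem weylVec_mixCopies (O : Matrix (Fin n) (Fin n) ℝ) (z : Fin n → Phase s) (k : Fin n) :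
    weylVec (mixCopies O z k) = mix O (fun l => weylVec (z l)) k := by
  funext a
  simp only [weylVec, mixCopies, mix_apply, Finset.sum_apply, Pi.smul_apply, smul_eq_mul]
  split_ifs
  · rfl
  · simp

/-- The exponents add up to the form `wᵗ β w` summed over the copies, and `w` depends linearly on
`z`, so it is mixed by the same `O`. -/
theorem IsCenteredGaussian.prod_trace_mixCopies {β : Matrix (Fin s × Fin 2) (Fin s × Fin 2) ℝ}
    {ρ : ModeSpace s →L[ℂ] ModeSpace s} (hρ : IsCenteredGaussian β ρ)
    {O : Matrix (Fin n) (Fin n) ℝ} (hO : O ∈ Matrix.orthogonalGroup (Fin n) ℝ)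
    (z : Fin n → Phase s) :
    ∏ k, trace (ρ * displacement (mixCopies O z k)) = ∏ k, trace (ρ * displacement (z k)) := by
  have h := sum_mix_mix hO ((dotProductBilin ℝ ℝ).compl₂ β.mulVecLin) (fun l => weylVec (z l))
    fun l => weylVec (z l)
  simp only [LinearMap.compl₂_apply, Matrix.mulVecLin_apply, ← weylVec_mixCopies] at h
  simp only [hρ.charFun_eq, ← Complex.exp_sum, ← Complex.ofReal_sum, neg_div,
    Finset.sum_neg_distrib, ← Finset.sum_div]
  rw [show (∑ k, weylVec (mixCopies O z k) ⬝ᵥ β.mulVec (weylVec (mixCopies O z k))) = _ from h]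
  rfl

/-- A positive trace class operator is determined by its quantum characteristic function. -/
theorem IsRankOneSum.eq_of_trace_mul_copyDisplacement {ι κ : Type*} [Countable ι] [Countable κ]
    {u : ι → CopySpace s n} {v : κ → CopySpace s n} {S T : CopySpace s n →L[ℂ] CopySpace s n}
    (hS : IsRankOneSum u S) (hT : IsRankOneSum v T)
    (h : ∀ z, trace (S * copyDisplacement z) = trace (T * copyDisplacement z)) : S = T := by
  -- The difference `S - T` is written as the single series `∑ |bᵢ⟩⟨aᵢ|`, the sign being carried by
  -- `b` alone.
  let a : ι ⊕ κ → CopySpace s n := Sum.elim u v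
  let b : ι ⊕ κ → CopySpace s n := Sum.elim u fun j => -v j
  have ha : Summable fun i => ‖a i‖ ^ 2 :=
    Summable.sum (fun i => ‖a i‖ ^ 2) hS.summable hT.summable
  have hb : Summable fun i => ‖b i‖ ^ 2 := ha.congr fun i => by
    rcases i with i | j
    · rfl
    · simp only [a, b, Sum.elim_inr, norm_neg]
  have hab : ∀ z, ∑' i, ⟪a i, copyDisplacement z (b i)⟫_ℂ = 0 := fun z => by
    have h1 : HasSum (fun i => ⟪a i, copyDisplacement z (b i)⟫_ℂ)
        (trace (S * copyDisplacement z) + -trace (T * copyDisplacement z)) := by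
      refine HasSum.sum ?_ ?_
      · rw [hS.trace_mul]
        exact (hS.summable_inner _).of_norm.hasSum
      · rw [hT.trace_mul]
        simpa only [a, b, Function.comp_def, Sum.elim_inr, map_neg, inner_neg_right] using
          (hT.summable_inner (copyDisplacement z)).of_norm.hasSum.neg
    rw [h1.tsum_eq, h, add_neg_cancel]
  refine ContinuousLinearMap.ext fun f => ext_inner_left ℂ fun g => ?_
  have h2 : HasSum (fun i => ⟪a i, f⟫_ℂ * ⟪g, b i⟫_ℂ) (⟪g, S f⟫_ℂ + -⟪g, T f⟫_ℂ) := by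
    refine HasSum.sum ?_ ?_
    · simpa only [a, b, Function.comp_def, Sum.elim_inl, mul_comm] using hS.hasSum g f
    · simpa only [a, b, Function.comp_def, Sum.elim_inr, inner_neg_right, mul_neg, mul_comm]
        using (hT.hasSum g f).neg
  have h3 := h2.tsum_eq
  rw [tsum_inner_mul_inner_eq_zero ha hb hab] at h3
  exact (add_neg_eq_zero.1 h3.symm)

theorem IsCenteredGaussian.conj_tensorOp {β : Matrix (Fin s × Fin 2) (Fin s × Fin 2) ℝ}
    {ρ : ModeSpace s →L[ℂ] ModeSpace s} (hρ : IsCenteredGaussian β ρ)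
    {O : Matrix (Fin n) (Fin n) ℝ} (hO : O ∈ Matrix.orthogonalGroup (Fin n) ℝ)
    {U : unitary (CopySpace s n →L[ℂ] CopySpace s n)} (hU : Implements U O) :
    star (U : CopySpace s n →L[ℂ] CopySpace s n) * tensorOp (fun _ : Fin n => ρ) * U =
      tensorOp fun _ : Fin n => ρ := by
  obtain ⟨ι, _, u, hu⟩ := hρ.isDensity.exists_isRankOneSum
  have hw : IsRankOneSum (fun I : Fin n → ι => tensorVec fun k => u (I k))
    (tensorOp fun _ => ρ) := hu.tensorOp
  have htr : ∀ z : Fin n → Phase s, trace (tensorOp (fun _ => ρ) * copyDisplacement z) =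
      ∏ k, trace (ρ * displacement (z k)) := fun z => by
    rw [hw.trace_mul]
    exact (hu.hasSum_tensorOp fun k => displacement (z k)).tsum_eq
  -- The trace identity moves `U` onto the displacement operator, so the characteristic function of
  -- the conjugated state at `z` is the original one at `Oz`. Undoing the conjugation then gives the
  -- form with `U*` on the left.
  have key : (U : CopySpace s n →L[ℂ] CopySpace s n) * tensorOp (fun _ : Fin n => ρ) *
      star (U : CopySpace s n →L[ℂ] CopySpace s n) = tensorOp fun _ : Fin n => ρ := by
    refine (hw.conj _).eq_of_trace_mul_copyDisplacement hw fun z => ?_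
    rw [hw.trace_conj_mul, hU, htr, htr, hρ.prod_trace_mixCopies hO]
  have h := conj_star_conj U (tensorOp fun _ : Fin n => ρ)
  rwa [key] at h

end GaussianInvariance

/-! ### Conjugated ensembles and output entropy -/

section ConjugateEnsembles

variable {K : Type} [NormedAddCommGroup K] [InnerProductSpace ℂ K] [CompleteSpace K]

theorem IsDensity.trace_conj_mul {ρ : K →L[ℂ] K} (hρ : IsDensity ρ) (V B : K →L[ℂ] K) :
    trace (V * ρ * star V * B) = trace (ρ * (star V * B * V)) := by
  obtain ⟨ι, _, u, hu⟩ := hρ.exists_isRankOneSum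
  exact hu.trace_conj_mul V B

theorem IsDensity.conj {ρ : K →L[ℂ] K} (hρ : IsDensity ρ) (U : unitary (K →L[ℂ] K)) :
    IsDensity ((U : K →L[ℂ] K) * ρ * star (U : K →L[ℂ] K)) where
  isPositive := by
    have := hρ.isPositive.conj_adjoint (U : K →L[ℂ] K)
    rwa [← ContinuousLinearMap.comp_assoc] at this
  trNorm_ne_top := ((trNorm_conj_le U ρ).trans_lt hρ.trNorm_ne_top.lt_top).ne
  trace_eq_one := by
    have h := hρ.trace_conj_mul (U : K →L[ℂ] K) 1
    rwa [mul_one, mul_one, Unitary.coe_star_mul_self, mul_one, hρ.trace_eq_one] at h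

/-- The ensemble of the states `U ρ(x) U*`. -/
def Ensemble.conj (E : Ensemble K) (U : unitary (K →L[ℂ] K)) : Ensemble K where
  X := E.X
  π := E.π
  ρ x := conjTraceClassIsometry U (E.ρ x)
  stronglyMeasurable_ρ :=
    (conjTraceClassIsometry U).continuous.comp_stronglyMeasurable E.stronglyMeasurable_ρ
  isDensity_ρ x := (E.isDensity_ρ x).conj U

/-- Conjugation is a linear isometry for the trace norm, so it commutes with the Bochner integral.
-/
theorem Ensemble.average_conj (E : Ensemble K) (U : unitary (K →L[ℂ] K)) :
    (E.conj U).average.toOp = (U : K →L[ℂ] K) * E.average.toOp * star (U : K →L[ℂ] K) := by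
  have h := (conjTraceClassIsometry U).integral_comp_comm (μ := E.π) E.ρ
  exact congrArg TraceClass.toOp h

/-- Each ensemble for `ρ`, once conjugated, competes for `UρU*`. Its output densities are the old
ones composed with `τ`, so the entropies are equal. With `τ` a measurable embedding, the change of
variables needs no measurability of the output density in `y`. -/
theorem entropyClosure_conj_le {Y : Type*} [MeasurableSpace Y] {m : Y → K →L[ℂ] K}
    {μ : Measure Y} {U : unitary (K →L[ℂ] K)} {τ : Y → Y} (hτ : MeasurePreserving τ μ μ)
    (hτe : MeasurableEmbedding τ)
    (hm : ∀ y, star (U : K →L[ℂ] K) * m y * U = m (τ y)) (ρ : K →L[ℂ] K) :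
    entropyClosure m μ ((U : K →L[ℂ] K) * ρ * star (U : K →L[ℂ] K)) ≤ entropyClosure m μ ρ := by
  refine le_iInf₂ fun E hE => ?_
  refine iInf₂_le_of_le (E.conj U) (by rw [E.average_conj, hE]) (le_of_eq ?_)
  refine lintegral_congr fun x => ?_
  change outEntropy m μ ((U : K →L[ℂ] K) * (E.ρ x).toOp * star (U : K →L[ℂ] K)) = _
  have h : ∀ y, outDensity m ((U : K →L[ℂ] K) * (E.ρ x).toOp * star (U : K →L[ℂ] K)) y =
      outDensity m (E.ρ x).toOp (τ y) := fun y => by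
    rw [outDensity, (E.isDensity_ρ x).trace_conj_mul, hm]
    rfl
  simp only [outEntropy, h]
  exact hτ.lintegral_comp_emb hτe
    fun y => ENNReal.ofReal (Real.negMulLog (outDensity m (E.ρ x).toOp y))

end ConjugateEnsembles

/-! ### Covariance of the measurement on `n` copies -/

section CopyEntropy

variable {s n : ℕ}

theorem copyPovmDensity_eq (ρ : ModeSpace s →L[ℂ] ModeSpace s) (z : Fin n → Phase s) :
    copyPovmDensity ρ z =
      copyDisplacement z * tensorOp (fun _ : Fin n => ρ) * star (copyDisplacement z) := by
  rw [copyDisplacement, star_tensorOp, ← tensorOp_mul, ← tensorOp_mul]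
  rfl

/-- Supplies the inverse data `(U*, Oᵗ)` from which the reverse entropy inequality follows. -/
theorem Implements.transpose {U : unitary (CopySpace s n →L[ℂ] CopySpace s n)}
    {O : Matrix (Fin n) (Fin n) ℝ} (hO : O ∈ Matrix.orthogonalGroup (Fin n) ℝ)
    (hU : Implements U O) : Implements (star U) O.transpose := fun z => by
  have h := hU (mixCopies O.transpose z)
  rw [show mixCopies O (mixCopies O.transpose z) = z from (mixEquiv O hO).right_inv z] at h
  rw [← h, ← Unitary.coe_star]
  have := conj_star_conj (star U) (copyDisplacement (mixCopies O.transpose z))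
  simpa using this

/-- Inserting `UU* = 1` between the three factors of `D(z) ρ^{⊗n} D(z)*` conjugates each separately:
the outer ones become `D(Oz)` and its adjoint, the middle one is fixed. -/
theorem conj_copyPovmDensity {ρ : ModeSpace s →L[ℂ] ModeSpace s}
    {U : unitary (CopySpace s n →L[ℂ] CopySpace s n)} {O : Matrix (Fin n) (Fin n) ℝ}
    (hU : Implements U O)
    (hρ : star (U : CopySpace s n →L[ℂ] CopySpace s n) * tensorOp (fun _ : Fin n => ρ) * U =
      tensorOp fun _ : Fin n => ρ) (z : Fin n → Phase s) :
    star (U : CopySpace s n →L[ℂ] CopySpace s n) * copyPovmDensity ρ z * U =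
      copyPovmDensity ρ (mixCopies O z) := by
  have h : (U : CopySpace s n →L[ℂ] CopySpace s n) * star (U : CopySpace s n →L[ℂ] CopySpace s n)
      = 1 := Unitary.coe_mul_star_self U
  rw [copyPovmDensity_eq, copyPovmDensity_eq, ← hU z]
  conv_rhs => rw [← hρ]
  simp only [star_mul, star_star, mul_assoc]
  simp only [← mul_assoc (U : CopySpace s n →L[ℂ] CopySpace s n)
    (star (U : CopySpace s n →L[ℂ] CopySpace s n)), h, one_mul]

instance isAddHaarMeasure_copyRefMeasure : (copyRefMeasure s n).IsAddHaarMeasure := by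
  have h : (refMeasure s).IsAddHaarMeasure :=
    Measure.IsAddHaarMeasure.smul _ (by simp; positivity) ENNReal.ofReal_ne_top
  exact Measure.pi.isAddHaarMeasure fun _ => refMeasure s

theorem measurableEmbedding_mixCopies {O : Matrix (Fin n) (Fin n) ℝ}
    (hO : O ∈ Matrix.orthogonalGroup (Fin n) ℝ) :
    MeasurableEmbedding (mixCopies O : (Fin n → Phase s) → _) :=
  let e : (Fin n → Phase s) ≃ₗ[ℝ] (Fin n → Phase s) := mixEquiv O hO
  e.toContinuousLinearEquiv.toHomeomorph.measurableEmbedding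

theorem IsCenteredGaussian.copyEntropyClosure_conj_le
    {β : Matrix (Fin s × Fin 2) (Fin s × Fin 2) ℝ} {ρ : ModeSpace s →L[ℂ] ModeSpace s}
    (hρ : IsCenteredGaussian β ρ) {O : Matrix (Fin n) (Fin n) ℝ}
    (hO : O ∈ Matrix.orthogonalGroup (Fin n) ℝ)
    {U : unitary (CopySpace s n →L[ℂ] CopySpace s n)} (hU : Implements U O)
    (σ : CopySpace s n →L[ℂ] CopySpace s n) :
    copyEntropyClosure n ρ (U * σ * star (U : CopySpace s n →L[ℂ] CopySpace s n)) ≤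
      copyEntropyClosure n ρ σ :=
  entropyClosure_conj_le (measurePreserving_mix hO (copyRefMeasure s n))
    (measurableEmbedding_mixCopies hO) (conj_copyPovmDensity hU (hρ.conj_tensorOp hO hU)) σ

end CopyEntropy

end QMeas

end

theorem lemma2 {s n : ℕ} (β : Matrix (Fin s × Fin 2) (Fin s × Fin 2) ℝ)
    (ρβ : QMeas.ModeSpace s →L[ℂ] QMeas.ModeSpace s) (hρβ : QMeas.IsCenteredGaussian β ρβ)
    (O : Matrix (Fin n) (Fin n) ℝ) (hO : O ∈ Matrix.orthogonalGroup (Fin n) ℝ) :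
    (∃ U : unitary (QMeas.CopySpace s n →L[ℂ] QMeas.CopySpace s n), QMeas.Implements U O) ∧
    ∀ U : unitary (QMeas.CopySpace s n →L[ℂ] QMeas.CopySpace s n), QMeas.Implements U O →
      star (U : QMeas.CopySpace s n →L[ℂ] QMeas.CopySpace s n) *
          QMeas.tensorOp (fun _ : Fin n => ρβ) * U = QMeas.tensorOp (fun _ : Fin n => ρβ) ∧
      ∀ ρ : QMeas.CopySpace s n →L[ℂ] QMeas.CopySpace s n, QMeas.IsDensity ρ →
        QMeas.copyEntropyClosure n ρβ ρ =
          QMeas.copyEntropyClosure n ρβ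
            (U * ρ * star (U : QMeas.CopySpace s n →L[ℂ] QMeas.CopySpace s n)) := by
  refine ⟨QMeas.exists_implements hO, fun U hU => ⟨hρβ.conj_tensorOp hO hU, fun ρ _ => ?_⟩⟩
  refine le_antisymm ?_ (hρβ.copyEntropyClosure_conj_le hO hU ρ)
  -- The inequality for `U*` at the state `UρU*`, whose conjugate by `U*` is `ρ` again.
  have h := hρβ.copyEntropyClosure_conj_le (QMeas.transpose_mem_orthogonalGroup hO) (hU.transpose hO)
    (U * ρ * star (U : QMeas.CopySpace s n →L[ℂ] QMeas.CopySpace s n))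
  rwa [Unitary.coe_star, star_star, QMeas.conj_star_conj] at h
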